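/- Let $n\ge 0$ and let $T^n=\{\lambda\in\mathbb R^{n+1}:\lambda_i\ge 0,\ \lambda_0+\dots+\lambda_n=1\}$ be the standard simplex. For $r\in\mathbb Z$ and $k\ge 0$, let $\mathcal P_r\Lambda^k(\mathbb R^{n+1})$ be the space of $k$-forms on $\mathbb R^{n+1}$ whose coefficients are real polynomials of degree at most $r$ (the zero space if $r<0$), and let $\mathcal P_r^-\Lambda^k(\mathbb R^{n+1})=i_X\,\mathcal P_{r-1}\Lambda^{k+1}(\mathbb R^{n+1})$, where $i_X$ is contraction with the position vector field $X$, that is, $(i_X\alpha)_\lambda(Y_1,\dots,Y_k)=\alpha_\lambda(\lambda,Y_1,\dots,Y_k)$. Let $\mathcal P_r\Lambda^k(T^n)$ and $\mathcal P_r^-\Lambda^k(T^n)$ be the images of these spaces under restriction of forms to $T^n$, and let $\mathring{\mathcal P}_r\Lambda^k(T^n)$ and $\mathring{\mathcal P}_r^-\Lambda^k(T^n)$ be their subspaces of forms whose trace (pullback along the inclusion) vanishes on every $(n-1)$-dimensional face of $T^n$. The symmetric group $S_{n+1}$ of permutations $\pi$ of $\{0,\dots,n\}$ acts on all these spaces by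 the pullbacks $S_\pi^*$, where $S_\pi(\lambda_0,\dots,\lambda_n)=(\lambda_{\pi(0)},\dots,\lambda_{\pi(n)})$. Let $\mathbf 1'$ be the one-dimensional real sign representation of $S_{n+1}$. Then for all $r\in\mathbb Z$ and $0\le k\le n$ there are isomorphisms of $S_{n+1}$-representations $$\mathcal P_r\Lambda^k(T^n)\cong\mathring{\mathcal P}_{r+k+1}^-\Lambda^{n-k}(T^n)\otimes\mathbf 1',\qquad \mathcal P_r^-\Lambda^k(T^n)\cong\mathring{\mathcal P}_{r+k}\Lambda^{n-k}(T^n)\otimes\mathbf 1',$$ except that the second one fails for $r=k=0$: $\mathcal P_0^-\Lambda^0(T^n)=0$, whereas $\mathring{\mathcal P}_0\Lambda^n(T^n)\ne 0$, so that $\mathcal P_0^-\Lambda^0(T^n)\not\cong\mathring{\mathcal P}_0\Lambda^n(T^n)\otimes\mathbf 1'$. -/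

import Mathlib

namespace FEEC

/-- Real polynomials in the coordinates `λ₀, …, λₙ` of degree at most `r`, where `r` is an integer;
only the zero polynomial if `r < 0`. -/
def polyLE (n : ℕ) (r : ℤ) : Submodule ℝ (MvPolynomial (Fin (n + 1)) ℝ) where
  carrier := {p | p = 0 ∨ (p.totalDegree : ℤ) ≤ r}
  zero_mem' := Or.inl rfl
  add_mem' := by
    rintro p q (rfl | hp) (rfl | hq)
    · simp
    · simpa using Or.inr hq
    · simpa using Or.inr hp
    · have := MvPolynomial.totalDegree_add p q
      right
      omega
  smul_mem' := by
    rintro c p (rfl | hp)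
    · simp
    · have := MvPolynomial.totalDegree_smul_le c p
      right
      omega

/-- `k`-forms on `ℝⁿ⁺¹`. No regularity is imposed here: below only forms with polynomial
coefficients are used. -/
abbrev Form (n k : ℕ) : Type :=
  (Fin (n + 1) → ℝ) → (Fin (n + 1) → ℝ) [⋀^Fin k]→ₗ[ℝ] ℝ

/-- `𝒫_r Λ^k(ℝⁿ⁺¹)`: the `k`-forms `ω` whose coefficients `ω(∂_{I 0}, …, ∂_{I (k-1)})` are
polynomials of degree at most `r`. -/
def polyForms (n : ℕ) (r : ℤ) (k : ℕ) : Submodule ℝ (Form n k) where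
  carrier := {ω | ∀ I : Fin k → Fin (n + 1), ∃ p ∈ polyLE n r,
    ∀ x, ω x (fun j => Pi.single (I j) 1) = MvPolynomial.eval x p}
  zero_mem' := fun _ => ⟨0, Submodule.zero_mem _, fun _ => by simp⟩
  add_mem' := by
    intro ω η hω hη I
    obtain ⟨p, hp, hpx⟩ := hω I
    obtain ⟨q, hq, hqx⟩ := hη I
    exact ⟨p + q, Submodule.add_mem _ hp hq, fun x => by simp [hpx, hqx]⟩
  smul_mem' := by
    intro c ω hω I
    obtain ⟨p, hp, hpx⟩ := hω I
    exact ⟨c • p, Submodule.smul_mem _ c hp, fun x => by simp [hpx, MvPolynomial.smul_eval]⟩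

/-- The contraction `i_X` with the position vector field `X`:
`(i_X α)_x (Y₁, …, Y_k) = α_x (x, Y₁, …, Y_k)`. -/
def contraction (n k : ℕ) : Form n (k + 1) →ₗ[ℝ] Form n k where
  toFun α := fun x => (α x).curryLeft x
  map_add' _ _ := rfl
  map_smul' _ _ := rfl

/-- `𝒫_r⁻ Λ^k(ℝⁿ⁺¹) = i_X (𝒫_{r-1} Λ^{k+1}(ℝⁿ⁺¹))`. -/
def polyFormsMinus (n : ℕ) (r : ℤ) (k : ℕ) : Submodule ℝ (Form n k) :=
  (polyForms n (r - 1) (k + 1)).map (contraction n k)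

/-- The tangent space of the standard simplex `Tⁿ` (the same at every point): the vectors of `ℝⁿ⁺¹`
with vanishing coordinate sum. -/
def tangent (n : ℕ) : Submodule ℝ (Fin (n + 1) → ℝ) where
  carrier := {v | ∑ i, v i = 0}
  zero_mem' := by simp
  add_mem' := by
    intro v w hv hw
    simp only [Set.mem_ofPred_eq] at hv hw ⊢
    simp [Finset.sum_add_distrib, hv, hw]
  smul_mem' := by
    intro c v hv
    simp only [Set.mem_ofPred_eq] at hv ⊢
    simp [← Finset.mul_sum, hv]

/-- `k`-forms on the standard simplex `Tⁿ ⊂ ℝⁿ⁺¹`. -/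
abbrev SimplexForm (n k : ℕ) : Type :=
  stdSimplex ℝ (Fin (n + 1)) → (tangent n) [⋀^Fin k]→ₗ[ℝ] ℝ

/-- The restriction of a `k`-form on `ℝⁿ⁺¹` to a `k`-form on `Tⁿ`. -/
def restrict (n k : ℕ) : Form n k →ₗ[ℝ] SimplexForm n k where
  toFun ω := fun x => (ω x.1).compLinearMap (tangent n).subtype
  map_add' _ _ := rfl
  map_smul' _ _ := rfl

/-- `𝒫_r Λ^k(Tⁿ)`. -/
def P (n : ℕ) (r : ℤ) (k : ℕ) : Submodule ℝ (SimplexForm n k) :=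
  (polyForms n r k).map (restrict n k)

/-- `𝒫_r⁻ Λ^k(Tⁿ)`. -/
def Pminus (n : ℕ) (r : ℤ) (k : ℕ) : Submodule ℝ (SimplexForm n k) :=
  (polyFormsMinus n r k).map (restrict n k)

/-- The facet of `Tⁿ` opposite to the `i`-th vertex, `{λ ∈ Tⁿ | λ_i = 0}`. As `i` varies these are
all the `(n-1)`-dimensional faces of `Tⁿ` (for `n = 0` the set is empty). -/
def facet (n : ℕ) (i : Fin (n + 1)) : Set (stdSimplex ℝ (Fin (n + 1))) :=
  {x | x.1 i = 0}

/-- The tangent space of the facet opposite to the `i`-th vertex. -/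
def facetTangent (n : ℕ) (i : Fin (n + 1)) : Submodule ℝ (tangent n) where
  carrier := {v | v.1 i = 0}
  zero_mem' := by simp
  add_mem' := by
    intro v w hv hw
    simp only [Set.mem_ofPred_eq] at hv hw ⊢
    simp [hv, hw]
  smul_mem' := by
    intro c v hv
    simp only [Set.mem_ofPred_eq] at hv ⊢
    simp [hv]

/-- The trace of a `k`-form on `Tⁿ` on the facet opposite to the `i`-th vertex: its pullback along
the inclusion of the facet. -/
def facetTrace (n k : ℕ) (i : Fin (n + 1)) :
    SimplexForm n k →ₗ[ℝ] (facet n i → (facetTangent n i) [⋀^Fin k]→ₗ[ℝ] ℝ) where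
  toFun ω := fun x => (ω x.1).compLinearMap (facetTangent n i).subtype
  map_add' _ _ := rfl
  map_smul' _ _ := rfl

/-- The `k`-forms on `Tⁿ` with vanishing trace on `∂Tⁿ`, i.e. on every facet. -/
def zeroTrace (n k : ℕ) : Submodule ℝ (SimplexForm n k) :=
  ⨅ i, LinearMap.ker (facetTrace n k i)

/-- `𝒫̊_r Λ^k(Tⁿ)`. -/
def P0 (n : ℕ) (r : ℤ) (k : ℕ) : Submodule ℝ (SimplexForm n k) :=
  P n r k ⊓ zeroTrace n k

/-- `𝒫̊_r⁻ Λ^k(Tⁿ)`. -/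
def Pminus0 (n : ℕ) (r : ℤ) (k : ℕ) : Submodule ℝ (SimplexForm n k) :=
  Pminus n r k ⊓ zeroTrace n k

/-- The linear map `(λ₀, …, λₙ) ↦ (λ_{π 0}, …, λ_{π n})` of `ℝⁿ⁺¹`. -/
def permMap (n : ℕ) (π : Equiv.Perm (Fin (n + 1))) :
    (Fin (n + 1) → ℝ) →ₗ[ℝ] (Fin (n + 1) → ℝ) :=
  LinearMap.funLeft ℝ ℝ π

/-- The induced map `S_π : Tⁿ → Tⁿ`. -/
def permSimplex (n : ℕ) (π : Equiv.Perm (Fin (n + 1))) (x : stdSimplex ℝ (Fin (n + 1))) :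
    stdSimplex ℝ (Fin (n + 1)) :=
  ⟨permMap n π x.1, fun i => x.2.1 (π i), (Equiv.sum_comp π x.1).trans x.2.2⟩

/-- The differential of `S_π`. -/
def permTangent (n : ℕ) (π : Equiv.Perm (Fin (n + 1))) : tangent n →ₗ[ℝ] tangent n :=
  (permMap n π).restrict fun v hv => (Equiv.sum_comp π v).trans hv

/-- The action of `S_{n+1}` on the `k`-forms on `Tⁿ`, where `π` acts by the pullback `S_π^*`. -/
def rep (n k : ℕ) : Representation ℝ (Equiv.Perm (Fin (n + 1))) (SimplexForm n k) where
  toFun π :=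
    { toFun := fun ω x => (ω (permSimplex n π x)).compLinearMap (permTangent n π)
      map_add' := fun _ _ => rfl
      map_smul' := fun _ _ => rfl }
  map_one' := rfl
  map_mul' _ _ := rfl

/-- Pullback of forms on `ℝⁿ⁺¹` by a permutation of the coordinates. -/
def pullbackForm (n k : ℕ) (π : Equiv.Perm (Fin (n + 1))) (ω : Form n k) : Form n k :=
  fun x => (ω (permMap n π x)).compLinearMap (permMap n π)

theorem rep_restrict (n k : ℕ) (π : Equiv.Perm (Fin (n + 1))) (ω : Form n k) :
    rep n k π (restrict n k ω) = restrict n k (pullbackForm n k π ω) := rfl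

theorem pullbackForm_mem {n k : ℕ} {r : ℤ} (π : Equiv.Perm (Fin (n + 1))) {ω : Form n k}
    (hω : ω ∈ polyForms n r k) : pullbackForm n k π ω ∈ polyForms n r k := by
  intro I
  obtain ⟨p, hp, hpx⟩ := hω (fun j => π.symm (I j))
  refine ⟨MvPolynomial.rename π p, ?_, fun x => ?_⟩
  · rcases hp with rfl | hp
    · exact Or.inl (by simp)
    · have := MvPolynomial.totalDegree_rename_le π p
      right
      omega
  · have hb : ∀ i : Fin (n + 1), permMap n π (Pi.single i 1) = Pi.single (π.symm i) 1 := by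
      intro i
      ext l
      simp [permMap, LinearMap.funLeft_apply, Pi.single_apply, Equiv.eq_symm_apply]
    have h := hpx (permMap n π x)
    simp only [pullbackForm, AlternatingMap.compLinearMap_apply, hb, MvPolynomial.eval_rename]
    exact h

theorem contraction_pullbackForm (n k : ℕ) (π : Equiv.Perm (Fin (n + 1))) (α : Form n (k + 1)) :
    pullbackForm n k π (contraction n k α) = contraction n k (pullbackForm n (k + 1) π α) := by
  funext x
  exact (AlternatingMap.curryLeft_compLinearMap (permMap n π) (α (permMap n π x)) x).symm

theorem P_invariant (n : ℕ) (r : ℤ) (k : ℕ) (π : Equiv.Perm (Fin (n + 1))) :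
    P n r k ≤ (P n r k).comap (rep n k π) := by
  rintro _ ⟨ω, hω, rfl⟩
  exact ⟨_, pullbackForm_mem π hω, (rep_restrict n k π ω).symm⟩

theorem Pminus_invariant (n : ℕ) (r : ℤ) (k : ℕ) (π : Equiv.Perm (Fin (n + 1))) :
    Pminus n r k ≤ (Pminus n r k).comap (rep n k π) := by
  rintro _ ⟨_, ⟨α, hα, rfl⟩, rfl⟩
  refine ⟨_, ⟨_, pullbackForm_mem π hα, rfl⟩, ?_⟩
  rw [rep_restrict, contraction_pullbackForm]

theorem zeroTrace_invariant (n k : ℕ) (π : Equiv.Perm (Fin (n + 1))) :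
    zeroTrace n k ≤ (zeroTrace n k).comap (rep n k π) := by
  intro ω hω
  simp only [zeroTrace, Submodule.mem_comap, Submodule.mem_iInf, LinearMap.mem_ker] at hω ⊢
  intro i
  have h := hω (π.symm i)
  funext x
  ext v
  have hx : permSimplex n π x.1 ∈ facet n (π.symm i) := by
    have := x.2
    simpa [facet, permSimplex, permMap, LinearMap.funLeft_apply] using this
  have hv : ∀ j, permTangent n π (v j).1 ∈ facetTangent n (π.symm i) := by
    intro j
    have : (v j).1.1 i = 0 := (v j).2
    change (v j).1.1 (π (π.symm i)) = 0
    simpa using this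
  exact DFunLike.congr_fun (congrFun h ⟨_, hx⟩) (fun j => ⟨_, hv j⟩)

/-- `𝒫_r Λ^k(Tⁿ)` as a representation of `S_{n+1}`. -/
def repP (n : ℕ) (r : ℤ) (k : ℕ) : Representation ℝ (Equiv.Perm (Fin (n + 1))) (P n r k) :=
  (rep n k).subrepresentation (P n r k) (P_invariant n r k)

/-- `𝒫_r⁻ Λ^k(Tⁿ)` as a representation of `S_{n+1}`. -/
def repPminus (n : ℕ) (r : ℤ) (k : ℕ) :
    Representation ℝ (Equiv.Perm (Fin (n + 1))) (Pminus n r k) :=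
  (rep n k).subrepresentation (Pminus n r k) (Pminus_invariant n r k)

/-- `𝒫̊_r Λ^k(Tⁿ)` as a representation of `S_{n+1}`. -/
def repP0 (n : ℕ) (r : ℤ) (k : ℕ) : Representation ℝ (Equiv.Perm (Fin (n + 1))) (P0 n r k) :=
  (rep n k).subrepresentation (P0 n r k) fun π _ hω =>
    ⟨P_invariant n r k π hω.1, zeroTrace_invariant n k π hω.2⟩

/-- `𝒫̊_r⁻ Λ^k(Tⁿ)` as a representation of `S_{n+1}`. -/
def repPminus0 (n : ℕ) (r : ℤ) (k : ℕ) :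
    Representation ℝ (Equiv.Perm (Fin (n + 1))) (Pminus0 n r k) :=
  (rep n k).subrepresentation (Pminus0 n r k) fun π _ hω =>
    ⟨Pminus_invariant n r k π hω.1, zeroTrace_invariant n k π hω.2⟩

/-- The one-dimensional sign representation of `S_{n+1}`. -/
def signRep (n : ℕ) : Representation ℝ (Equiv.Perm (Fin (n + 1))) ℝ where
  toFun π := ((Equiv.Perm.sign π : ℤ) : ℝ) • LinearMap.id
  map_one' := by ext; simp
  map_mul' _ _ := by ext; simp [mul_comm]

end FEEC

namespace FEEC

open MvPolynomial

/-! Everything is lifted to forms on `ℝⁿ⁺¹` with homogeneous coefficients. Write `H_r Λ^k` for such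
forms of degree `r`, `s = dλ₀ + ⋯ + dλₙ`, and `i_X` for `contractPos`. Since `∑ λ_i = 1` on the
simplex, every polynomial form restricts to it like a homogeneous one. An element of `H_r Λ^k`
restricts to zero iff `s ∧ ω = 0`, while a form `i_X α` restricts to zero only if it is zero,
because `X` is transversal to the simplex. Thus `𝒫_r Λ^k(Tⁿ)` is `H_r Λ^k / ker (s ∧ ·)` and `𝒫_r⁻
Λ^k(Tⁿ)` is `H_{r-1} Λ^{k+1} / ker i_X`.

The duality is the weighted Hodge star `⋆ : dλ_I ↦ ± λ_I dλ_{Iᶜ}`. It is injective, its image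
consists of the forms with vanishing trace on all coordinate hyperplanes (`star_mem_vanishing`,
`exists_star_eq`), it exchanges `i_X` and `s ∧ ·` up to sign (`contractPos_star`, `wedgeSum_star`),
and it commutes with permutations up to their sign (`star_permAct`).

Hence `ω ↦ i_X ⋆ω` on `H_r Λ^k` has kernel `ker (s ∧ ·)`, and `α ↦ ⋆α`, restricted to the simplex,
has kernel `ker i_X` on `H_{r-1} Λ^{k+1}`. Both land in the zero-trace spaces. They are onto because
`s ∧ ·` and `i_X` are exact: the first always, the second except at the constants in degree zero,
whence the exception `r = k = 0`. -/

/-- The tuple of coordinate vectors with indices `I`. -/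
abbrev basisTuple {n k : ℕ} (I : Fin k → Fin (n + 1)) : Fin k → (Fin (n + 1) → ℝ) :=
  fun j => Pi.single (I j) 1

/-! ### Alternating maps and their coefficients on coordinate vectors. -/

section Coefficients

variable {n k m : ℕ} {N : Type*} [AddCommGroup N] [Module ℝ N]

theorem alternating_ext {ω η : (Fin (n + 1) → ℝ) [⋀^Fin k]→ₗ[ℝ] N}
    (h : ∀ I : Fin k → Fin (n + 1), Function.Injective I →
      ω (basisTuple I) = η (basisTuple I)) : ω = η := by
  refine Module.Basis.ext_alternating (Pi.basisFun ℝ (Fin (n + 1))) fun I hI => ?_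
  simpa [Pi.basisFun_apply] using h I hI

theorem alternating_ext_all {ω η : (Fin (n + 1) → ℝ) [⋀^Fin k]→ₗ[ℝ] N}
    (h : ∀ I : Fin k → Fin (n + 1), ω (basisTuple I) = η (basisTuple I)) : ω = η :=
  alternating_ext fun I _ => h I

theorem apply_basisTuple_of_not_injective (ω : (Fin (n + 1) → ℝ) [⋀^Fin k]→ₗ[ℝ] N)
    {I : Fin k → Fin (n + 1)} (hI : ¬ Function.Injective I) : ω (basisTuple I) = 0 := by
  rw [Function.not_injective_iff] at hI
  obtain ⟨a, b, hab, hne⟩ := hI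
  exact ω.map_eq_zero_of_eq _ (congrArg (fun i => Pi.single i (1 : ℝ)) hab) hne

theorem apply_basisTuple_comp (ω : (Fin (n + 1) → ℝ) [⋀^Fin k]→ₗ[ℝ] N)
    (I : Fin k → Fin (n + 1)) (σ : Equiv.Perm (Fin k)) :
    ω (basisTuple (I ∘ σ)) = Equiv.Perm.sign σ • ω (basisTuple I) :=
  ω.map_perm (basisTuple I) σ

/-- The alternating map with prescribed antisymmetric coefficients. -/
noncomputable def ofCoeff (c : (Fin k → Fin (n + 1)) → N)
    (hc : ∀ I a b, a ≠ b → c (I ∘ Equiv.swap a b) = -c I) :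
    (Fin (n + 1) → ℝ) [⋀^Fin k]→ₗ[ℝ] N where
  toMultilinearMap := ∑ I : Fin k → Fin (n + 1),
    ((MultilinearMap.mkPiAlgebra ℝ (Fin k) ℝ).compLinearMap
      (fun a => LinearMap.proj (I a))).smulRight (c I)
  map_eq_zero_of_eq' := by
    intro v a b hab hne
    have hv : ∀ i, v (Equiv.swap a b i) = v i := by
      intro i
      rcases eq_or_ne i a with rfl | hia
      · simp [hab]
      rcases eq_or_ne i b with rfl | hib
      · simp [hab]
      rw [Equiv.swap_apply_of_ne_of_ne hia hib]
    simp only [MultilinearMap.toFun_eq_coe, sum_apply, MultilinearMap.smulRight_apply,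
      MultilinearMap.compLinearMap_apply, MultilinearMap.mkPiAlgebra_apply, LinearMap.proj_apply]
    -- Reindexing by the swap preserves each product, as `v a = v b`, and negates `c I`, so the sum
    -- equals its own negative.
    have key : ∑ I : Fin k → Fin (n + 1), (∏ i, v i (I i)) • c I =
        -∑ I : Fin k → Fin (n + 1), (∏ i, v i (I i)) • c I := by
      rw [← Finset.sum_neg_distrib]
      refine Fintype.sum_equiv ((Equiv.swap a b).arrowCongr (Equiv.refl _)) _ _ fun I => ?_
      have h1 : ((Equiv.swap a b).arrowCongr (Equiv.refl _)) I = I ∘ Equiv.swap a b := by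
        ext; simp [Equiv.arrowCongr]
      rw [h1, hc _ _ _ hne, smul_neg, neg_neg]
      congr 1
      rw [← Equiv.prod_comp (Equiv.swap a b)]
      simp [hv]
    have h2 : (2 : ℝ) • ∑ I : Fin k → Fin (n + 1), (∏ i, v i (I i)) • c I = 0 := by
      rw [two_smul]
      nth_rw 1 [key]
      simp
    exact (smul_eq_zero.mp h2).resolve_left two_ne_zero

@[simp]
theorem ofCoeff_apply (c : (Fin k → Fin (n + 1)) → N)
    (hc : ∀ I a b, a ≠ b → c (I ∘ Equiv.swap a b) = -c I) (I : Fin k → Fin (n + 1)) :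
    ofCoeff c hc (basisTuple I) = c I := by
  change (∑ J : Fin k → Fin (n + 1),
    ((MultilinearMap.mkPiAlgebra ℝ (Fin k) ℝ).compLinearMap
      (fun a => LinearMap.proj (J a))).smulRight (c J)) (basisTuple I) = c I
  simp only [sum_apply, MultilinearMap.smulRight_apply,
      MultilinearMap.compLinearMap_apply, MultilinearMap.mkPiAlgebra_apply, LinearMap.proj_apply]
  rw [Finset.sum_eq_single I]
  · simp
  · intro J _ hJ
    obtain ⟨a, ha⟩ := Function.ne_iff.mp hJ
    rw [Finset.prod_eq_zero (Finset.mem_univ a) (by simp [ha]), zero_smul]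
  · simp

end Coefficients

/-! ### Complementary index tuples, encoded as bijections, and their signs. -/

section Complement

variable {n k m : ℕ}

theorem exists_equiv_inr (h : k + m = n + 1) {J : Fin m → Fin (n + 1)}
    (hJ : Function.Injective J) : ∃ e : Fin k ⊕ Fin m ≃ Fin (n + 1), ∀ b, e (.inr b) = J b := by
  classical
  have hc : Fintype.card ((Set.range J)ᶜ : Set (Fin (n + 1))) = k := by
    rw [Fintype.card_compl_set, Set.card_range_of_injective hJ]
    simp; omega
  let e1 : Fin k ≃ ((Set.range J)ᶜ : Set (Fin (n + 1))) := (Fintype.equivFinOfCardEq hc).symm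
  refine ⟨(e1.sumCongr (Equiv.ofInjective J hJ)).trans
    ((Equiv.sumComm _ _).trans (Equiv.Set.sumCompl (Set.range J))), fun b => by simp⟩

theorem exists_equiv_inl (h : k + m = n + 1) {I : Fin k → Fin (n + 1)}
    (hI : Function.Injective I) : ∃ e : Fin k ⊕ Fin m ≃ Fin (n + 1), ∀ a, e (.inl a) = I a := by
  obtain ⟨e, he⟩ := exists_equiv_inr (k := m) (m := k) (by omega) hI
  exact ⟨(Equiv.sumComm _ _).trans e, fun a => by simp [he]⟩

/-- The sign of a bijection `Fin k ⊕ Fin m ≃ Fin (n + 1)`, relative to a fixed one. -/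
def bijSign (h : k + m = n + 1) (e : Fin k ⊕ Fin m ≃ Fin (n + 1)) : ℤˣ :=
  Equiv.Perm.sign ((finSumFinEquiv.trans (finCongr h)).symm.trans e)

theorem bijSign_trans (h : k + m = n + 1) (e : Fin k ⊕ Fin m ≃ Fin (n + 1))
    (π : Equiv.Perm (Fin (n + 1))) :
    bijSign h (e.trans π) = Equiv.Perm.sign π * bijSign h e := by
  rw [bijSign, bijSign, ← Equiv.Perm.sign_mul]
  rfl

theorem bijSign_perm_trans (h : k + m = n + 1) (e : Fin k ⊕ Fin m ≃ Fin (n + 1))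
    (σ : Equiv.Perm (Fin k ⊕ Fin m)) :
    bijSign h (σ.trans e) = Equiv.Perm.sign σ * bijSign h e := by
  set e0 : Fin k ⊕ Fin m ≃ Fin (n + 1) := finSumFinEquiv.trans (finCongr h) with he0
  have : e0.symm.trans (σ.trans e) = (e0.symm.trans e) * (e0.symm.trans (σ.trans e0)) := by
    ext x; simp [Equiv.Perm.mul_apply]
  rw [bijSign, bijSign, ← he0, this, Equiv.Perm.sign_mul, mul_comm]
  congr 1
  exact Equiv.Perm.sign_symm_trans_trans σ e0

/-- Moves the first element of the left block to the front of the right block. -/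
def shiftEquiv (k m : ℕ) : Fin k ⊕ Fin (m + 1) ≃ Fin (k + 1) ⊕ Fin m where
  toFun := Sum.elim (fun a => .inl a.succ) (Fin.cases (.inl 0) fun b => .inr b)
  invFun := Sum.elim (Fin.cases (.inr 0) fun a => .inl a) fun b => .inr b.succ
  left_inv := by
    rintro (a | b)
    · simp
    · refine Fin.cases ?_ (fun b => ?_) b <;> simp
  right_inv := by
    rintro (a | b)
    · refine Fin.cases ?_ (fun b => ?_) a <;> simp
    · simp

@[simp] theorem shiftEquiv_inl (a : Fin k) : shiftEquiv k m (.inl a) = .inl a.succ := rfl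
@[simp] theorem shiftEquiv_inr_zero : shiftEquiv k m (.inr 0) = .inl 0 := rfl
@[simp] theorem shiftEquiv_inr_succ (b : Fin m) : shiftEquiv k m (.inr b.succ) = .inr b := rfl
@[simp] theorem shiftEquiv_symm_inl_zero : (shiftEquiv k m).symm (.inl 0) = .inr 0 := rfl
@[simp] theorem shiftEquiv_symm_inl_succ (a : Fin k) :
    (shiftEquiv k m).symm (.inl a.succ) = .inl a := rfl
@[simp] theorem shiftEquiv_symm_inr (b : Fin m) :
    (shiftEquiv k m).symm (.inr b) = .inr b.succ := rfl

/-- The sign by which `bijSign` changes under `shiftEquiv`. -/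
def shiftSign (h : k + 1 + m = n + 1) : ℤˣ :=
  bijSign (k := k) (m := m + 1) (by omega)
    ((shiftEquiv k m).trans (finSumFinEquiv.trans (finCongr h)))

/-- The factor does not depend on `e`: any `e` is the reference bijection followed by a permutation
of the target, which multiplies both signs equally. -/
theorem bijSign_shift (h : k + 1 + m = n + 1) (h' : k + (m + 1) = n + 1)
    (e : Fin (k + 1) ⊕ Fin m ≃ Fin (n + 1)) :
    bijSign h' ((shiftEquiv k m).trans e) = shiftSign h * bijSign h e := by
  set e0 : Fin (k + 1) ⊕ Fin m ≃ Fin (n + 1) := finSumFinEquiv.trans (finCongr h) with he0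
  have : (shiftEquiv k m).trans e =
      ((shiftEquiv k m).trans e0).trans (e0.symm.trans e : Equiv.Perm (Fin (n + 1))) := by
    ext x; simp
  rw [this, bijSign_trans, mul_comm]
  rfl

end Complement

/-! ### The weighted Hodge star, its injectivity and its image. -/

section Duality

variable {n k m : ℕ} {N : Type*} [AddCommGroup N]

theorem eq_sumCongr_trans {e e' : Fin k ⊕ Fin m ≃ Fin (n + 1)}
    (h : ∀ b, e' (.inr b) = e (.inr b)) :
    ∃ σ : Equiv.Perm (Fin k), e' = (Equiv.sumCongr σ (Equiv.refl _)).trans e := by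
  have hr : ∀ b, (e'.trans e.symm) (.inr b) = .inr b := fun b => by simp [h]
  have hl : Set.MapsTo (e'.trans e.symm) (Set.range Sum.inl) (Set.range Sum.inl) := by
    rintro _ ⟨a, rfl⟩
    rcases hx : (e'.trans e.symm) (.inl a) with a' | b
    · exact ⟨a', rfl⟩
    · rw [← hr b] at hx
      simpa using (e'.trans e.symm).injective hx
  obtain ⟨⟨σ, τ⟩, hp⟩ := Equiv.Perm.mem_sumCongrHom_range_of_perm_mapsTo_inl hl
  refine ⟨σ, Equiv.ext fun x => ?_⟩
  rcases x with a | b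
  · have := DFunLike.congr_fun hp (.inl a)
    simp only [Equiv.Perm.sumCongrHom_apply, Equiv.Perm.sumCongr_apply, Sum.map_inl,
      Equiv.trans_apply] at this
    simp [this]
  · simp [h]

open Classical in
/-- The coefficients of an alternating map given by a function of the bijections
`Fin k ⊕ Fin m ≃ Fin (n + 1)`. -/
noncomputable def bijCoeff (φ : (Fin k ⊕ Fin m ≃ Fin (n + 1)) → N) (J : Fin m → Fin (n + 1)) : N :=
  if hJ : ∃ e : Fin k ⊕ Fin m ≃ Fin (n + 1), ∀ b, e (.inr b) = J b then φ hJ.choose else 0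

/-- Two bijections with the same right block differ by a permutation of the left block, to which `φ`
is insensitive; so the choice made in `bijCoeff` is immaterial. -/
theorem bijCoeff_eq {φ : (Fin k ⊕ Fin m ≃ Fin (n + 1)) → N}
    (hφ : ∀ σ τ e, φ ((Equiv.sumCongr σ τ).trans e) = Equiv.Perm.sign τ • φ e)
    (e : Fin k ⊕ Fin m ≃ Fin (n + 1)) {J : Fin m → Fin (n + 1)} (he : ∀ b, e (.inr b) = J b) :
    bijCoeff φ J = φ e := by
  have hJ : ∃ e : Fin k ⊕ Fin m ≃ Fin (n + 1), ∀ b, e (.inr b) = J b := ⟨e, he⟩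
  rw [bijCoeff, dif_pos hJ]
  obtain ⟨σ, hσ⟩ := eq_sumCongr_trans (e := e) (e' := hJ.choose)
    fun b => (hJ.choose_spec b).trans (he b).symm
  rw [hσ, hφ]
  simp

theorem bijCoeff_swap {φ : (Fin k ⊕ Fin m ≃ Fin (n + 1)) → N}
    (hφ : ∀ σ τ e, φ ((Equiv.sumCongr σ τ).trans e) = Equiv.Perm.sign τ • φ e)
    (J : Fin m → Fin (n + 1)) (a b : Fin m) (hab : a ≠ b) :
    bijCoeff φ (J ∘ Equiv.swap a b) = -bijCoeff φ J := by
  by_cases hJ : ∃ e : Fin k ⊕ Fin m ≃ Fin (n + 1), ∀ b, e (.inr b) = J b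
  · obtain ⟨e, he⟩ := hJ
    rw [bijCoeff_eq hφ e he, bijCoeff_eq hφ (J := J ∘ Equiv.swap a b)
      ((Equiv.sumCongr (Equiv.refl _) (Equiv.swap a b)).trans e) (fun c => he _), hφ,
      Equiv.Perm.sign_swap hab]
    simp
  · have hJ' : ¬ ∃ e : Fin k ⊕ Fin m ≃ Fin (n + 1), ∀ c, e (.inr c) = (J ∘ Equiv.swap a b) c := by
      rintro ⟨e, he⟩
      refine hJ ⟨(Equiv.sumCongr (Equiv.refl _) (Equiv.swap a b)).trans e, fun c => ?_⟩
      exact (he _).trans (congrArg J (Equiv.swap_apply_self a b c))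
    rw [bijCoeff, bijCoeff, dif_neg hJ, dif_neg hJ', neg_zero]

/-- The alternating map whose coefficients are given by a function of the bijections
`Fin k ⊕ Fin m ≃ Fin (n + 1)`. -/
noncomputable def ofBijections [Module ℝ N] (φ : (Fin k ⊕ Fin m ≃ Fin (n + 1)) → N)
    (hφ : ∀ σ τ e, φ ((Equiv.sumCongr σ τ).trans e) = Equiv.Perm.sign τ • φ e) :
    (Fin (n + 1) → ℝ) [⋀^Fin m]→ₗ[ℝ] N :=
  ofCoeff (bijCoeff φ) (bijCoeff_swap hφ)

theorem ofBijections_apply [Module ℝ N] {φ : (Fin k ⊕ Fin m ≃ Fin (n + 1)) → N}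
    (hφ : ∀ σ τ e, φ ((Equiv.sumCongr σ τ).trans e) = Equiv.Perm.sign τ • φ e)
    (e : Fin k ⊕ Fin m ≃ Fin (n + 1)) {J : Fin m → Fin (n + 1)} (he : ∀ b, e (.inr b) = J b) :
    ofBijections φ hφ (basisTuple J) = φ e := by
  rw [ofBijections, ofCoeff_apply, bijCoeff_eq hφ e he]

/-- `k`-forms on `ℝⁿ⁺¹` with polynomial coefficients. -/
abbrev PolyAlt (n k : ℕ) : Type :=
  (Fin (n + 1) → ℝ) [⋀^Fin k]→ₗ[ℝ] MvPolynomial (Fin (n + 1)) ℝ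

theorem bijSign_sumCongr_trans (h : k + m = n + 1) (e : Fin k ⊕ Fin m ≃ Fin (n + 1))
    (σ : Equiv.Perm (Fin k)) (τ : Equiv.Perm (Fin m)) :
    bijSign h ((Equiv.sumCongr σ τ).trans e) =
      Equiv.Perm.sign σ * Equiv.Perm.sign τ * bijSign h e := by
  rw [← Equiv.Perm.sign_sumCongr]
  exact bijSign_perm_trans h e (Equiv.sumCongr σ τ)

/-- The sign of `σ` occurs twice, in `bijSign` and in the coefficient of `ω`, and cancels; the
monomial is symmetric. Only the sign of `τ` survives. -/
theorem star_aux (h : k + m = n + 1) (ω : PolyAlt n k) (σ : Equiv.Perm (Fin k))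
    (τ : Equiv.Perm (Fin m)) (e : Fin k ⊕ Fin m ≃ Fin (n + 1)) :
    bijSign h ((Equiv.sumCongr σ τ).trans e) •
      ((∏ a, X (((Equiv.sumCongr σ τ).trans e) (.inl a))) *
        ω (basisTuple fun a => ((Equiv.sumCongr σ τ).trans e) (.inl a))) =
    Equiv.Perm.sign τ • bijSign h e •
      ((∏ a, X (e (.inl a))) * ω (basisTuple fun a => e (.inl a))) := by
  have h1 : bijSign h ((Equiv.sumCongr σ τ).trans e) =
      Equiv.Perm.sign σ * Equiv.Perm.sign τ * bijSign h e := 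
    bijSign_sumCongr_trans h e σ τ
  have h2 : ω (basisTuple fun a => ((Equiv.sumCongr σ τ).trans e) (.inl a)) =
      Equiv.Perm.sign σ • ω (basisTuple fun a => e (.inl a)) :=
    apply_basisTuple_comp ω (fun a => e (.inl a)) σ
  have h3 : ∏ a, (X (((Equiv.sumCongr σ τ).trans e) (.inl a)) : MvPolynomial (Fin (n + 1)) ℝ) =
      ∏ a, X (e (.inl a)) :=
    Equiv.prod_comp σ (fun a => (X (e (.inl a)) : MvPolynomial (Fin (n + 1)) ℝ))
  rw [h1, h2, h3, mul_smul_comm, smul_smul, smul_smul]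
  congr 1
  rw [mul_right_comm, mul_right_comm (Equiv.Perm.sign σ), Int.units_mul_self, one_mul]

/-- The weighted Hodge star `dλ_I ↦ ± λ_I dλ_{Iᶜ}`. -/
noncomputable def star (h : k + m = n + 1) : PolyAlt n k →ₗ[ℝ] PolyAlt n m where
  toFun ω := ofBijections (fun e => bijSign h e •
    ((∏ a, X (e (.inl a))) * ω (basisTuple fun a => e (.inl a)))) (star_aux h ω)
  map_add' ω η := alternating_ext fun J hJ => by
    obtain ⟨e, he⟩ := exists_equiv_inr h hJ
    simp [ofBijections_apply _ e he, mul_add, smul_add]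
  map_smul' c ω := alternating_ext fun J hJ => by
    obtain ⟨e, he⟩ := exists_equiv_inr h hJ
    simp [ofBijections_apply _ e he, smul_comm c]

theorem star_apply (h : k + m = n + 1) (ω : PolyAlt n k) (e : Fin k ⊕ Fin m ≃ Fin (n + 1))
    {I : Fin k → Fin (n + 1)} {J : Fin m → Fin (n + 1)}
    (hI : ∀ a, e (.inl a) = I a) (hJ : ∀ b, e (.inr b) = J b) :
    star h ω (basisTuple J) = bijSign h e • ((∏ a, X (I a)) * ω (basisTuple I)) := by
  obtain rfl : (fun a => e (.inl a)) = I := funext hI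
  exact ofBijections_apply (star_aux h ω) e hJ

theorem star_injective (h : k + m = n + 1) : Function.Injective (star (n := n) h) := by
  rw [← LinearMap.ker_eq_bot, LinearMap.ker_eq_bot']
  intro ω hω
  refine alternating_ext fun I hI => ?_
  obtain ⟨e, he⟩ := exists_equiv_inl h hI
  have := star_apply h ω e he (fun b => rfl)
  rw [hω, AlternatingMap.zero_apply, eq_comm, Units.smul_def, zsmul_eq_mul] at this
  simp only [mul_eq_zero, Finset.prod_eq_zero_iff, X_ne_zero, and_false, exists_false,
    false_or] at this
  simpa using this

/-- The polynomial forms whose trace on each coordinate hyperplane vanishes. -/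
def vanishing (n m : ℕ) : Submodule ℝ (PolyAlt n m) where
  carrier := {η | ∀ (i : Fin (n + 1)) (J : Fin m → Fin (n + 1)), (∀ b, J b ≠ i) →
    X i ∣ η (basisTuple J)}
  zero_mem' := fun _ _ _ => dvd_zero _
  add_mem' := fun h1 h2 i J hJ => dvd_add (h1 i J hJ) (h2 i J hJ)
  smul_mem' := fun c η h i J hJ => by
    simpa [smul_eq_C_mul] using (h i J hJ).mul_left (C c)

/-- An index missing from `J` lies in the complementary block, so its variable is a factor of the
monomial. -/
theorem star_mem_vanishing (h : k + m = n + 1) (ω : PolyAlt n k) :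
    star h ω ∈ vanishing n m := by
  intro i J hJ
  by_cases hinj : Function.Injective J
  · obtain ⟨e, he⟩ := exists_equiv_inr h hinj
    rw [star_apply h ω e (fun _ => rfl) he, Units.smul_def, zsmul_eq_mul]
    refine Dvd.dvd.mul_left (Dvd.dvd.mul_right ?_ _) _
    obtain ⟨x, rfl⟩ := e.surjective i
    rcases x with a | b
    · exact Finset.dvd_prod_of_mem (fun a => X (e (.inl a))) (Finset.mem_univ a)
    · exact absurd (he b).symm (hJ b)
  · rw [apply_basisTuple_of_not_injective _ hinj]
    exact dvd_zero _

theorem prod_X_dvd {I : Fin k → Fin (n + 1)} (hI : Function.Injective I)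
    {p : MvPolynomial (Fin (n + 1)) ℝ} (hp : ∀ a, X (I a) ∣ p) : ∏ a, X (I a) ∣ p := by
  refine Finset.prod_dvd_of_isRelPrime (fun a _ b _ hab => ?_) fun a _ => hp a
  refine (Irreducible.isRelPrime_iff_not_dvd (X_prime (i := I a)).irreducible).mpr fun hd => ?_
  exact hab (hI (by simpa using X_dvd_X.mp hd))

/-- The coefficient of `η` at `J` is divisible by `X i` for each `i` outside `J`, hence by the
product of these distinct primes. The quotients inherit antisymmetry by cancelling the monomial, so
they are the coefficients of a form. -/
theorem exists_star_eq (h : k + m = n + 1) {η : PolyAlt n m} (hη : η ∈ vanishing n m) :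
    ∃ ω : PolyAlt n k, star h ω = η := by
  have hq : ∀ e : Fin k ⊕ Fin m ≃ Fin (n + 1), ∃ q : MvPolynomial (Fin (n + 1)) ℝ,
      bijSign h e • η (basisTuple fun b => e (.inr b)) = (∏ a, X (e (.inl a))) * q := by
    intro e
    have : (∏ a, X (e (.inl a))) ∣ η (basisTuple fun b => e (.inr b)) :=
      prod_X_dvd (fun a b hab => by simpa using hab) fun a => hη _ _ (fun b => by simp)
    rw [Units.smul_def, zsmul_eq_mul]
    exact this.mul_left _
  choose q hq using hq
  have hP : ∀ e : Fin k ⊕ Fin m ≃ Fin (n + 1),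
      (∏ a, X (e (.inl a)) : MvPolynomial (Fin (n + 1)) ℝ) ≠ 0 := fun e =>
    Finset.prod_ne_zero_iff.mpr fun a _ => X_ne_zero _
  have hqq : ∀ (σ : Equiv.Perm (Fin k)) (τ : Equiv.Perm (Fin m))
      (e : Fin k ⊕ Fin m ≃ Fin (n + 1)),
      q ((Equiv.sumCongr σ τ).trans e) = Equiv.Perm.sign σ • q e := by
    intro σ τ e
    have h1 : bijSign h ((Equiv.sumCongr σ τ).trans e) =
        Equiv.Perm.sign σ * Equiv.Perm.sign τ * bijSign h e := 
      bijSign_sumCongr_trans h e σ τ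
    have h2 : η (basisTuple fun a => ((Equiv.sumCongr σ τ).trans e) (.inr a)) =
        Equiv.Perm.sign τ • η (basisTuple fun a => e (.inr a)) :=
      apply_basisTuple_comp η (fun a => e (.inr a)) τ
    have h3 : ∏ a, (X (((Equiv.sumCongr σ τ).trans e) (.inl a)) : MvPolynomial (Fin (n + 1)) ℝ) =
        ∏ a, X (e (.inl a)) :=
      Equiv.prod_comp σ (fun a => (X (e (.inl a)) : MvPolynomial (Fin (n + 1)) ℝ))
    have h4 := hq ((Equiv.sumCongr σ τ).trans e)
    rw [h1, h2, h3] at h4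
    refine mul_left_cancel₀ (hP e) ?_
    rw [← h4, mul_smul_comm, ← hq, smul_smul, smul_smul]
    congr 1
    rw [mul_right_comm, mul_assoc (Equiv.Perm.sign σ), Int.units_mul_self, mul_one]
  -- `ofBijections` reads its index tuple from the right block, so the two blocks are exchanged.
  let ω : PolyAlt n k := ofBijections (fun e => q ((Equiv.sumComm _ _).trans e))
    fun σ τ e => by
      rw [← hqq τ σ ((Equiv.sumComm _ _).trans e)]
      congr 1
      ext x
      rcases x with a | b <;> rfl
  refine ⟨ω, alternating_ext fun J hJ => ?_⟩
  obtain ⟨e, he⟩ := exists_equiv_inr h hJ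
  have h1 : ω (basisTuple fun a => e (.inl a)) = q e := by
    rw [ofBijections_apply _ ((Equiv.sumComm _ _).trans e) (J := fun a => e (.inl a))
      (fun b => rfl)]
    congr 1
    ext x
    rcases x with a | b <;> rfl
  rw [star_apply h ω e (fun _ => rfl) he, h1, ← hq, smul_smul, Int.units_mul_self, one_smul]
  simp [he]

end Duality

/-! ### Exterior product, contraction and exterior derivative, and how the star relates the first
two. -/

section Operators

variable {n k m : ℕ} {N : Type*} [AddCommGroup N] [Module ℝ N]

theorem alternating_sum_apply {ι : Type*} (s : Finset ι)
    (f : ι → (Fin (n + 1) → ℝ) [⋀^Fin k]→ₗ[ℝ] N) (v : Fin k → Fin (n + 1) → ℝ) :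
    (∑ i ∈ s, f i) v = ∑ i ∈ s, f i v := by
  classical
  induction s using Finset.induction_on with
  | empty => simp
  | insert a s ha ih => rw [Finset.sum_insert ha, Finset.sum_insert ha, AlternatingMap.add_apply, ih]

/-- The linear form `dλ₀ + ⋯ + dλₙ`. -/
noncomputable def sumForm (n : ℕ) : (Fin (n + 1) → ℝ) →ₗ[ℝ] ℝ := ∑ i, LinearMap.proj i

@[simp]
theorem sumForm_apply (v : Fin (n + 1) → ℝ) : sumForm n v = ∑ i, v i := by
  simp [sumForm]

section Wedge

variable {M M' : Type*} [AddCommGroup M] [Module ℝ M] [AddCommGroup M'] [Module ℝ M']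

/-- The exterior product with a linear form. -/
noncomputable def wedge (f : M →ₗ[ℝ] ℝ) : M [⋀^Fin k]→ₗ[ℝ] N →ₗ[ℝ] M [⋀^Fin (k + 1)]→ₗ[ℝ] N where
  toFun ω := AlternatingMap.alternatizeUncurryFin (f.smulRight ω)
  map_add' ω η := by
    ext v
    simp [AlternatingMap.alternatizeUncurryFin_apply, Finset.sum_add_distrib]
  map_smul' c ω := by
    ext v
    simp [AlternatingMap.alternatizeUncurryFin_apply, Finset.smul_sum, smul_comm c]

theorem wedge_apply (f : M →ₗ[ℝ] ℝ) (ω : M [⋀^Fin k]→ₗ[ℝ] N) (v : Fin (k + 1) → M) :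
    wedge f ω v = ∑ a : Fin (k + 1), (-1) ^ (a : ℕ) • f (v a) • ω (a.removeNth v) := by
  simp [wedge, AlternatingMap.alternatizeUncurryFin_apply]

theorem wedge_compLinearMap (f : M →ₗ[ℝ] ℝ) (g : M' →ₗ[ℝ] M) (ω : M [⋀^Fin k]→ₗ[ℝ] N) :
    (wedge f ω).compLinearMap g = wedge (f ∘ₗ g) (ω.compLinearMap g) := by
  ext v
  simp only [AlternatingMap.compLinearMap_apply, wedge_apply]
  rfl

/-- The summand `a = 0` gives `f v • ω`; in the others `v` stays in front. For `f v = 1` this makes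
contraction with `v` a contracting homotopy for `wedge f`. -/
theorem curryLeft_wedge (f : M →ₗ[ℝ] ℝ) (ω : M [⋀^Fin (k + 1)]→ₗ[ℝ] N) (v : M) :
    (wedge f ω).curryLeft v = f v • ω - wedge f (ω.curryLeft v) := by
  ext w
  rw [AlternatingMap.curryLeft_apply_apply, wedge_apply, Fin.sum_univ_succ,
    AlternatingMap.sub_apply, wedge_apply, sub_eq_add_neg, ← Finset.sum_neg_distrib]
  congr 1
  · simp [Matrix.vecCons]
  · refine Finset.sum_congr rfl fun a _ => ?_
    have : (Fin.removeNth a.succ (Matrix.vecCons v w)) = Matrix.vecCons v (a.removeNth w) := by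
      ext i : 1
      refine Fin.cases ?_ (fun i => ?_) i <;> simp [Fin.removeNth]
    rw [this]
    simp [pow_succ]

theorem curryLeft_wedge_zero (f : M →ₗ[ℝ] ℝ) (ω : M [⋀^Fin 0]→ₗ[ℝ] N) (v : M) :
    (wedge f ω).curryLeft v = f v • ω := by
  ext w
  rw [AlternatingMap.curryLeft_apply_apply, wedge_apply, Fin.sum_univ_succ]
  simp

theorem vecCons_zero_succ {α : Type*} (v : Fin (k + 1) → α) :
    Matrix.vecCons (v 0) (fun i => v i.succ) = v := by
  ext i : 1
  refine Fin.cases ?_ (fun i => ?_) i <;> simp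

theorem eq_zero_of_curryLeft {ω : M [⋀^Fin (k + 1)]→ₗ[ℝ] N} (h : ∀ v, ω.curryLeft v = 0) :
    ω = 0 := by
  ext v
  have h0 := DFunLike.congr_fun (h (v 0)) (fun i => v i.succ)
  rwa [AlternatingMap.curryLeft_apply_apply, vecCons_zero_succ] at h0

theorem wedge_wedge (f : M →ₗ[ℝ] ℝ) (ω : M [⋀^Fin k]→ₗ[ℝ] N) : wedge f (wedge f ω) = 0 := by
  induction k with
  | zero =>
    refine eq_zero_of_curryLeft fun v => ?_
    rw [curryLeft_wedge, curryLeft_wedge_zero, map_smul, sub_self]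
  | succ k ih =>
    refine eq_zero_of_curryLeft fun v => ?_
    rw [curryLeft_wedge, curryLeft_wedge, map_sub, map_smul, ih, sub_zero, sub_self]

theorem eq_wedge_of_wedge_eq_zero {f : M →ₗ[ℝ] ℝ} {v : M} (hv : f v = 1)
    {η : M [⋀^Fin (k + 1)]→ₗ[ℝ] N} (h : wedge f η = 0) : η = wedge f (η.curryLeft v) := by
  have := curryLeft_wedge f η v
  rw [h, AlternatingMap.curryLeft_zero, eq_comm, LinearMap.zero_apply, sub_eq_zero, hv,
    one_smul] at this
  exact this

/-- A form which is annihilated by contraction with `v` and vanishes on a hyperplane transversal to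
`v` is zero. -/
theorem eq_zero_of_curryLeft_of_ker {f : M →ₗ[ℝ] ℝ} {v : M} (hv : f v = 1)
    {η : M [⋀^Fin (k + 1)]→ₗ[ℝ] N} (h : η.curryLeft v = 0)
    (h0 : ∀ w : Fin (k + 1) → M, (∀ a, f (w a) = 0) → η w = 0) : η = 0 := by
  have hu : ∀ (w : Fin (k + 1) → M) a, η (Function.update w a v) = 0 := by
    intro w a
    rw [← Fin.insertNth_removeNth, AlternatingMap.map_insertNth,
      ← AlternatingMap.curryLeft_apply_apply, h]
    simp
  ext w
  -- Projecting the arguments one by one to the kernel of `f` along `v` does not change the value.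
  have key : ∀ s : Finset (Fin (k + 1)),
      η (fun a => if a ∈ s then w a - f (w a) • v else w a) = η w := by
    intro s
    induction s using Finset.induction_on with
    | empty => simp
    | insert b s hb ih =>
      have : (fun a => if a ∈ insert b s then w a - f (w a) • v else w a) =
          Function.update (fun a => if a ∈ s then w a - f (w a) • v else w a) b
            (w b - f (w b) • v) := by
        ext a : 1
        rcases eq_or_ne a b with rfl | hab
        · simp
        · simp [hab]
      rw [this, AlternatingMap.map_update_sub, AlternatingMap.map_update_smul, hu, smul_zero,
        sub_zero, ← ih]
      congr 1
      rw [Function.update_eq_self_iff]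
      simp [hb]
  rw [← key Finset.univ]
  simp only [Finset.mem_univ, if_true, AlternatingMap.zero_apply]
  exact h0 _ fun a => by simp [hv]

/-- For the converse in positive degree, `η - f ∧ i_v η` is killed by contraction with `v` and
vanishes on the kernel of `f`, hence is zero; then `f ∧ f = 0` applies. -/
theorem wedge_eq_zero_iff {f : M →ₗ[ℝ] ℝ} {v : M} (hv : f v = 1) (η : M [⋀^Fin k]→ₗ[ℝ] N) :
    wedge f η = 0 ↔ ∀ w : Fin k → M, (∀ a, f (w a) = 0) → η w = 0 := by
  cases k with
  | zero =>
    constructor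
    · intro h w _
      have := curryLeft_wedge_zero f η v
      rw [h, AlternatingMap.curryLeft_zero, hv, one_smul] at this
      rw [← this]
      rfl
    · intro h
      have : η = 0 := by
        ext w
        exact h w fun a => a.elim0
      rw [this, map_zero]
  | succ k =>
    constructor
    · intro h w hw
      rw [eq_wedge_of_wedge_eq_zero hv h, wedge_apply]
      simp [hw]
    · intro h
      have h2 : η - wedge f (η.curryLeft v) = 0 := by
        refine eq_zero_of_curryLeft_of_ker hv ?_ fun w hw => ?_
        · change η.curryLeft v - (wedge f (η.curryLeft v)).curryLeft v = 0
          cases k with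
          | zero => rw [curryLeft_wedge_zero, hv, one_smul, sub_self]
          | succ k =>
            rw [curryLeft_wedge, hv, one_smul, AlternatingMap.curryLeft_same, map_zero, sub_zero,
              sub_self]
        · rw [AlternatingMap.sub_apply, h w hw, wedge_apply]
          simp [hw]
      rw [sub_eq_zero.mp h2, wedge_wedge]

end Wedge

/-- The exterior product with `dλ₀ + ⋯ + dλₙ`. -/
noncomputable abbrev wedgeSum : (Fin (n + 1) → ℝ) [⋀^Fin k]→ₗ[ℝ] N →ₗ[ℝ]
    (Fin (n + 1) → ℝ) [⋀^Fin (k + 1)]→ₗ[ℝ] N := wedge (sumForm n)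

theorem wedgeSum_basisTuple (ω : (Fin (n + 1) → ℝ) [⋀^Fin k]→ₗ[ℝ] N)
    (I : Fin (k + 1) → Fin (n + 1)) :
    wedgeSum ω (basisTuple I) =
      ∑ a : Fin (k + 1), (-1) ^ (a : ℕ) • ω (basisTuple fun i => I (a.succAbove i)) := by
  rw [wedge_apply]
  refine Finset.sum_congr rfl fun a _ => ?_
  simp
  rfl

theorem eq_zero_of_card_lt (hk : n + 1 < k) (ω : (Fin (n + 1) → ℝ) [⋀^Fin k]→ₗ[ℝ] N) : ω = 0 := by
  refine alternating_ext fun I hI => ?_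
  have := Fintype.card_le_of_injective I hI
  simp at this
  omega

theorem eq_wedgeSum_of_wedgeSum_eq_zero {η : (Fin (n + 1) → ℝ) [⋀^Fin (k + 1)]→ₗ[ℝ] N}
    (h : wedgeSum η = 0) : η = wedgeSum (η.curryLeft (Pi.single 0 1)) :=
  eq_wedge_of_wedge_eq_zero (by simp) h

/-- The contraction of a form with polynomial coefficients with the position vector field. -/
noncomputable def contractPos : PolyAlt n (k + 1) →ₗ[ℝ] PolyAlt n k where
  toFun ω := ∑ j, (X j : MvPolynomial (Fin (n + 1)) ℝ) • ω.curryLeft (Pi.single j 1)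
  map_add' ω η := by simp [Finset.sum_add_distrib]
  map_smul' c ω := by simp [Finset.smul_sum, smul_comm c]

theorem vecCons_basisTuple (j : Fin (n + 1)) (J : Fin k → Fin (n + 1)) :
    Matrix.vecCons (Pi.single j 1) (basisTuple J) = basisTuple (Fin.cons j J) := by
  ext i : 1
  refine Fin.cases ?_ (fun i => ?_) i <;> simp [basisTuple]

theorem contractPos_basisTuple (ω : PolyAlt n (k + 1)) (J : Fin k → Fin (n + 1)) :
    contractPos ω (basisTuple J) = ∑ j, X j * ω (basisTuple (Fin.cons j J)) := by
  change (∑ j, (X j : MvPolynomial (Fin (n + 1)) ℝ) • ω.curryLeft (Pi.single j 1)) _ = _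
  simp only [alternating_sum_apply, AlternatingMap.smul_apply, AlternatingMap.curryLeft_apply_apply,
    vecCons_basisTuple, smul_eq_mul]

/-- In the coefficient at `J`, indices `j` in `J` drop out as repetitions. An index `j` in the
complement `I` leaves `I` without `j`, and the factor `X j` restores the full monomial of `I`; this
is a term of `s ∧ ω` at `I`. -/
theorem contractPos_star (h : k + 1 + m = n + 1) (h' : k + (m + 1) = n + 1) (ω : PolyAlt n k) :
    contractPos (star h' ω) = shiftSign h • star h (wedgeSum ω) := by
  refine alternating_ext fun J hJ => ?_
  obtain ⟨e, he⟩ := exists_equiv_inr h hJ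
  rw [contractPos_basisTuple, ← e.sum_comp, Fintype.sum_sum_type, AlternatingMap.smul_apply,
    star_apply h _ e (fun _ => rfl) he, wedgeSum_basisTuple, Finset.mul_sum, Finset.smul_sum,
    Finset.smul_sum, Finset.sum_eq_zero (s := (Finset.univ : Finset (Fin m))), add_zero]
  · refine Finset.sum_congr rfl fun a _ => ?_
    -- The cycle brings entry `a` to the front of the left block, at the cost of `(-1) ^ a`, and
    -- `shiftEquiv` passes it to the right block.
    rw [star_apply h' ω ((shiftEquiv k m).trans
        ((Equiv.sumCongr a.cycleRange.symm (Equiv.refl _)).trans e))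
        (I := fun i => e (.inl (a.succAbove i))) (by simp [Fin.cycleRange_symm_succ])
        (by
          intro b
          refine Fin.cases ?_ (fun b => ?_) b
          · simp [Fin.cycleRange_symm_zero]
          · simp [he]),
      bijSign_shift h, bijSign_sumCongr_trans, Fin.prod_univ_succAbove _ a]
    simp only [Equiv.Perm.sign_symm, Fin.sign_cycleRange, Units.smul_def, zsmul_eq_mul]
    simp
    ring
  · intro b _
    rw [apply_basisTuple_of_not_injective, mul_zero]
    intro hinj
    have := @hinj 0 b.succ (by simp [he])
    exact absurd this (Fin.succ_ne_zero b).symm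

/-- The mirror image of `contractPos_star`: deleting `J b` from `J` adds it to the complement and `X
(J b)` to the monomial. The sign `(-1) ^ b` of the exterior product cancels that of the cycle. -/
theorem wedgeSum_star (h : k + 1 + m = n + 1) (h' : k + (m + 1) = n + 1)
    (α : PolyAlt n (k + 1)) :
    wedgeSum (star h α) = shiftSign h • star h' (contractPos α) := by
  refine alternating_ext fun J hJ => ?_
  obtain ⟨e, he⟩ := exists_equiv_inr h' hJ
  rw [wedgeSum_basisTuple, AlternatingMap.smul_apply, star_apply h' _ e (fun _ => rfl) he,
    contractPos_basisTuple, ← e.sum_comp, Fintype.sum_sum_type,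
    Finset.sum_eq_zero (s := (Finset.univ : Finset (Fin k))), zero_add, Finset.mul_sum,
    Finset.smul_sum, Finset.smul_sum]
  · refine Finset.sum_congr rfl fun b _ => ?_
    set f := (Equiv.sumCongr (Equiv.refl (Fin k)) b.cycleRange.symm).trans e with hf
    have hs : bijSign h ((shiftEquiv k m).symm.trans f) = shiftSign h * bijSign h' f := by
      have := bijSign_shift h h' ((shiftEquiv k m).symm.trans f)
      rw [← Equiv.trans_assoc, Equiv.self_trans_symm, Equiv.refl_trans] at this
      rw [this, ← mul_assoc, Int.units_mul_self, one_mul]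
    rw [star_apply h α ((shiftEquiv k m).symm.trans f)
        (I := Fin.cons (J b) fun i => e (.inl i))
        (J := fun i => J (b.succAbove i))
        (by
          intro a
          refine Fin.cases ?_ (fun a => ?_) a
          · simp [hf, Fin.cycleRange_symm_zero, he]
          · simp [hf])
        (by simp [hf, Fin.cycleRange_symm_succ, he]),
      hs, hf, bijSign_sumCongr_trans, Fin.prod_univ_succ]
    simp only [Equiv.Perm.sign_symm, Fin.sign_cycleRange, Units.smul_def, zsmul_eq_mul, he]
    simp
    ring_nf
    rw [pow_mul', neg_one_sq, one_pow, mul_one]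
  · intro a _
    rw [apply_basisTuple_of_not_injective, mul_zero]
    intro hinj
    have := @hinj 0 a.succ (by simp)
    exact absurd this (Fin.succ_ne_zero a).symm

/-- The exterior derivative of a form with polynomial coefficients. -/
noncomputable def extDer (ω : PolyAlt n k) : PolyAlt n (k + 1) :=
  AlternatingMap.alternatizeUncurryFin
    (∑ j, (LinearMap.proj j).smulRight ((pderiv j).toLinearMap.compAlternatingMap ω))

theorem extDer_basisTuple (ω : PolyAlt n k) (I : Fin (k + 1) → Fin (n + 1)) :
    extDer ω (basisTuple I) = ∑ a : Fin (k + 1), (-1) ^ (a : ℕ) •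
      pderiv (I a) (ω (basisTuple fun i => I (a.succAbove i))) := by
  rw [extDer, AlternatingMap.alternatizeUncurryFin_apply]
  refine Finset.sum_congr rfl fun a _ => ?_
  congr 1
  simp [Pi.single_apply]
  rfl

theorem cons_removeNth_apply (ω : (Fin (n + 1) → ℝ) [⋀^Fin (k + 1)]→ₗ[ℝ] N)
    (I : Fin (k + 1) → Fin (n + 1)) (a : Fin (k + 1)) :
    ω (basisTuple (Fin.cons (I a) fun i => I (a.succAbove i))) =
      (-1) ^ (a : ℕ) • ω (basisTuple I) := by
  have h : (Fin.cons (I a) fun i => I (a.succAbove i) : Fin (k + 1) → Fin (n + 1)) =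
      I ∘ a.cycleRange.symm := by
    ext i : 1
    refine Fin.cases ?_ (fun i => ?_) i
    · simp [Fin.cycleRange_symm_zero]
    · simp [Fin.cycleRange_symm_succ]
  rw [h, apply_basisTuple_comp, Equiv.Perm.sign_symm, Fin.sign_cycleRange, Units.smul_def]
  simp

/-- Cartan's formula for the Lie derivative along the position vector field. -/
theorem contractPos_extDer_add (ω : PolyAlt n (k + 1)) :
    contractPos (extDer ω) + extDer (contractPos ω) =
      (∑ j, (X j : MvPolynomial (Fin (n + 1)) ℝ) • (pderiv j).toLinearMap.compAlternatingMap ω) +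
        ((k + 1 : ℕ) : ℝ) • ω := by
  refine alternating_ext_all fun I => ?_
  -- Deleting the contracted index gives the Euler derivative; the remaining sum cancels against
  -- that in `h2`.
  have h1 : contractPos (extDer ω) (basisTuple I) =
      (∑ j, X j * pderiv j (ω (basisTuple I))) -
      ∑ a : Fin (k + 1), (-1) ^ (a : ℕ) * ∑ j, X j *
        pderiv (I a) (ω (basisTuple (Fin.cons j fun i => I (a.succAbove i)))) := by
    rw [contractPos_basisTuple]
    simp_rw [extDer_basisTuple, Finset.mul_sum]
    rw [Finset.sum_comm (s := (Finset.univ : Finset (Fin (k + 1)))), ← Finset.sum_sub_distrib]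
    refine Finset.sum_congr rfl fun j _ => ?_
    rw [Fin.sum_univ_succ, sub_eq_add_neg, ← Finset.sum_neg_distrib]
    congr 1
    · simp
    · refine Finset.sum_congr rfl fun a _ => ?_
      have : (fun i => (Fin.cons j I : Fin (k + 2) → Fin (n + 1)) (a.succ.succAbove i)) =
          Fin.cons j fun i => I (a.succAbove i) := by
        ext i : 1
        refine Fin.cases ?_ (fun i => ?_) i <;> simp
      rw [this]
      simp [pow_succ]
      ring
  -- In the Leibniz rule, differentiating `X j` returns `ω` once for each of the `k + 1` positions.
  have h2 : extDer (contractPos ω) (basisTuple I) =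
      ((k + 1 : ℕ) : MvPolynomial (Fin (n + 1)) ℝ) * ω (basisTuple I) +
      ∑ a : Fin (k + 1), (-1) ^ (a : ℕ) * ∑ j, X j *
        pderiv (I a) (ω (basisTuple (Fin.cons j fun i => I (a.succAbove i)))) := by
    rw [extDer_basisTuple]
    have : ((k + 1 : ℕ) : MvPolynomial (Fin (n + 1)) ℝ) * ω (basisTuple I) =
        ∑ a : Fin (k + 1), (-1) ^ (a : ℕ) *
          ω (basisTuple (Fin.cons (I a) fun i => I (a.succAbove i))) := by
      simp_rw [cons_removeNth_apply]
      simp [← mul_assoc, ← mul_pow]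
    rw [this, ← Finset.sum_add_distrib]
    refine Finset.sum_congr rfl fun a _ => ?_
    rw [contractPos_basisTuple, map_sum]
    simp_rw [Derivation.leibniz, pderiv_X, smul_eq_mul, Finset.sum_add_distrib]
    simp [Pi.single_apply]
    ring
  rw [AlternatingMap.add_apply, h1, h2, AlternatingMap.add_apply, AlternatingMap.smul_apply,
    smul_eq_C_mul]
  simp only [alternating_sum_apply, AlternatingMap.smul_apply, LinearMap.compAlternatingMap_apply,
    smul_eq_mul, map_natCast]
  simp

theorem contractPos_extDer_zero (ω : PolyAlt n 0) :
    contractPos (extDer ω) =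
      ∑ j, (X j : MvPolynomial (Fin (n + 1)) ℝ) • (pderiv j).toLinearMap.compAlternatingMap ω := by
  refine alternating_ext_all fun I => ?_
  rw [contractPos_basisTuple]
  simp only [alternating_sum_apply, AlternatingMap.smul_apply, LinearMap.compAlternatingMap_apply,
    smul_eq_mul]
  refine Finset.sum_congr rfl fun j _ => ?_
  rw [extDer_basisTuple]
  simp [Subsingleton.elim (basisTuple (n := n) (k := 0) _) (basisTuple I)]

end Operators

/-! ### Homogeneous polynomials and forms; exactness of the Koszul complex. -/

section Homogeneous

variable {n k m : ℕ}

/-- The homogeneous polynomials of degree `r`; only zero if `r < 0`. -/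
def homPoly (n : ℕ) (r : ℤ) : Submodule ℝ (MvPolynomial (Fin (n + 1)) ℝ) where
  carrier := {p | ∀ d, coeff d p ≠ 0 → (d.degree : ℤ) = r}
  zero_mem' := by simp
  add_mem' := by
    intro p q hp hq d hd
    by_cases h : coeff d p = 0
    · exact hq d (by simpa [h] using hd)
    · exact hp d h
  smul_mem' := by
    intro c p hp d hd
    refine hp d fun h => hd ?_
    simp [h]

theorem mem_homPoly_natCast {r : ℕ} {p : MvPolynomial (Fin (n + 1)) ℝ} :
    p ∈ homPoly n r ↔ p.IsHomogeneous r := by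
  constructor
  · intro h d hd
    have := h d hd
    rw [Finsupp.degree_eq_weight_one] at this
    exact_mod_cast this
  · intro h d hd
    rw [Finsupp.degree_eq_weight_one]
    exact_mod_cast h hd

theorem eq_zero_of_mem_homPoly {r : ℤ} (hr : r < 0) {p : MvPolynomial (Fin (n + 1)) ℝ}
    (hp : p ∈ homPoly n r) : p = 0 := by
  ext d
  by_contra h
  have := hp d h
  omega

theorem mul_mem_homPoly {r s t : ℤ} (ht : r + s = t) {p q : MvPolynomial (Fin (n + 1)) ℝ}
    (hp : p ∈ homPoly n r) (hq : q ∈ homPoly n s) : p * q ∈ homPoly n t := by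
  rcases lt_or_ge r 0 with hr | hr
  · simp [eq_zero_of_mem_homPoly hr hp]
  rcases lt_or_ge s 0 with hs | hs
  · simp [eq_zero_of_mem_homPoly hs hq]
  lift r to ℕ using hr
  lift s to ℕ using hs
  subst ht
  exact_mod_cast mem_homPoly_natCast.mpr
    ((mem_homPoly_natCast.mp hp).mul (mem_homPoly_natCast.mp hq))

theorem X_mem_homPoly (i : Fin (n + 1)) : (X i : MvPolynomial (Fin (n + 1)) ℝ) ∈ homPoly n 1 := by
  exact_mod_cast mem_homPoly_natCast.mpr (isHomogeneous_X ℝ i)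

theorem prod_X_mem_homPoly (I : Fin k → Fin (n + 1)) :
    (∏ a, X (I a) : MvPolynomial (Fin (n + 1)) ℝ) ∈ homPoly n k := by
  refine mem_homPoly_natCast.mpr ?_
  simpa using IsHomogeneous.prod Finset.univ (fun a => (X (I a) : MvPolynomial (Fin (n + 1)) ℝ))
    (fun _ => 1) fun a _ => isHomogeneous_X ℝ (I a)

/-- Multiplication by a monomial merely translates exponents. -/
theorem mem_homPoly_of_prod_X_mul {r s : ℤ} (I : Fin k → Fin (n + 1)) (hs : r + k = s)
    {p : MvPolynomial (Fin (n + 1)) ℝ} (hp : (∏ a, X (I a)) * p ∈ homPoly n s) :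
    p ∈ homPoly n r := by
  intro d hd
  have h1 : (∏ a, X (I a) : MvPolynomial (Fin (n + 1)) ℝ) =
      monomial (∑ a, Finsupp.single (I a) 1) 1 := by
    rw [monomial_sum_one]; rfl
  have h2 := hp ((∑ a, Finsupp.single (I a) 1) + d) (by
    rw [h1, coeff_monomial_mul]
    simpa using hd)
  rw [map_add, map_sum] at h2
  simp at h2
  omega

theorem pderiv_mem_homPoly {r : ℤ} (i : Fin (n + 1)) {p : MvPolynomial (Fin (n + 1)) ℝ}
    (hp : p ∈ homPoly n r) : pderiv i p ∈ homPoly n (r - 1) := by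
  rcases lt_or_ge r 0 with hr | hr
  · simp [eq_zero_of_mem_homPoly hr hp]
  lift r to ℕ using hr
  rw [mem_homPoly_natCast] at hp
  rcases r with _ | r
  · rw [← totalDegree_zero_iff_isHomogeneous, totalDegree_eq_zero_iff_eq_C] at hp
    rw [hp, pderiv_C]
    exact Submodule.zero_mem _
  · have := mem_homPoly_natCast.mpr (hp.pderiv (i := i))
    simpa using this

theorem euler_homPoly {r : ℤ} {p : MvPolynomial (Fin (n + 1)) ℝ} (hp : p ∈ homPoly n r) :
    ∑ i, X i * pderiv i p = (r : ℝ) • p := by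
  rcases lt_or_ge r 0 with hr | hr
  · simp [eq_zero_of_mem_homPoly hr hp]
  lift r to ℕ using hr
  rw [(mem_homPoly_natCast.mp hp).sum_X_mul_pderiv]
  simp [nsmul_eq_mul, smul_eq_C_mul]

/-- The forms whose coefficients are homogeneous polynomials of degree `r`. -/
def homForms (n : ℕ) (r : ℤ) (k : ℕ) : Submodule ℝ (PolyAlt n k) where
  carrier := {ω | ∀ I, ω (basisTuple I) ∈ homPoly n r}
  zero_mem' := fun _ => Submodule.zero_mem _
  add_mem' := fun h1 h2 I => Submodule.add_mem _ (h1 I) (h2 I)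
  smul_mem' := fun c _ h I => Submodule.smul_mem _ c (h I)

theorem eq_zero_of_mem_homForms {r : ℤ} (hr : r < 0) {ω : PolyAlt n k} (h : ω ∈ homForms n r k) :
    ω = 0 :=
  alternating_ext_all fun I => eq_zero_of_mem_homPoly hr (h I)

theorem units_smul_mem {M : Type*} [AddCommGroup M] [Module ℝ M] {p : Submodule ℝ M} {x : M}
    (u : ℤˣ) : u • x ∈ p ↔ x ∈ p := by
  rcases Int.units_eq_one_or u with rfl | rfl <;> simp [Units.smul_def]

theorem star_mem_homForms (h : k + m = n + 1) {r s : ℤ} (hs : r + k = s) {ω : PolyAlt n k} :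
    star h ω ∈ homForms n s m ↔ ω ∈ homForms n r k := by
  constructor
  · intro hω I
    by_cases hI : Function.Injective I
    · obtain ⟨e, he⟩ := exists_equiv_inl h hI
      have := hω fun b => e (.inr b)
      rw [star_apply h ω e he fun _ => rfl, units_smul_mem] at this
      exact mem_homPoly_of_prod_X_mul I hs this
    · rw [apply_basisTuple_of_not_injective _ hI]
      exact Submodule.zero_mem _
  · intro hω J
    by_cases hJ : Function.Injective J
    · obtain ⟨e, he⟩ := exists_equiv_inr h hJ
      rw [star_apply h ω e (fun _ => rfl) he, units_smul_mem]
      exact mul_mem_homPoly (by omega) (prod_X_mem_homPoly _) (hω _)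
    · rw [apply_basisTuple_of_not_injective _ hJ]
      exact Submodule.zero_mem _

theorem wedgeSum_mem_homForms {r : ℤ} {ω : PolyAlt n k} (hω : ω ∈ homForms n r k) :
    wedgeSum ω ∈ homForms n r (k + 1) := by
  intro I
  rw [wedgeSum_basisTuple]
  refine Submodule.sum_mem _ fun a _ => ?_
  rcases neg_one_pow_eq_or ℤ (a : ℕ) with h | h <;> simp [h, hω _]

theorem contractPos_mem_homForms {r s : ℤ} (hs : r + 1 = s) {ω : PolyAlt n (k + 1)}
    (hω : ω ∈ homForms n r (k + 1)) : contractPos ω ∈ homForms n s k := by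
  intro I
  rw [contractPos_basisTuple]
  exact Submodule.sum_mem _ fun j _ => mul_mem_homPoly (by omega) (X_mem_homPoly j) (hω _)

theorem curryLeft_mem_homForms {r : ℤ} {ω : PolyAlt n (k + 1)} (hω : ω ∈ homForms n r (k + 1))
    (j : Fin (n + 1)) : ω.curryLeft (Pi.single j 1) ∈ homForms n r k := by
  intro I
  rw [AlternatingMap.curryLeft_apply_apply, vecCons_basisTuple]
  exact hω _

theorem extDer_mem_homForms {r : ℤ} {ω : PolyAlt n k} (hω : ω ∈ homForms n r k) :
    extDer ω ∈ homForms n (r - 1) (k + 1) := by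
  intro I
  rw [extDer_basisTuple]
  refine Submodule.sum_mem _ fun a _ => ?_
  rcases neg_one_pow_eq_or ℤ (a : ℕ) with h | h <;> simp [h, pderiv_mem_homPoly _ (hω _)]

theorem euler_homForms {r : ℤ} {ω : PolyAlt n k} (hω : ω ∈ homForms n r k) :
    ∑ j, (X j : MvPolynomial (Fin (n + 1)) ℝ) • (pderiv j).toLinearMap.compAlternatingMap ω =
      (r : ℝ) • ω := by
  refine alternating_ext_all fun I => ?_
  simp only [alternating_sum_apply, AlternatingMap.smul_apply, LinearMap.compAlternatingMap_apply,
    smul_eq_mul]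
  exact euler_homPoly (hω I)

/-- Exactness of the Koszul complex. -/
theorem exists_contractPos_eq_succ {r : ℤ} {ω : PolyAlt n (k + 1)} (hω : ω ∈ homForms n r (k + 1))
    (h0 : contractPos ω = 0) : ∃ α ∈ homForms n (r - 1) (k + 2), contractPos α = ω := by
  rcases lt_or_ge r 0 with hr | hr
  · exact ⟨0, Submodule.zero_mem _, by rw [map_zero, eq_zero_of_mem_homForms hr hω]⟩
  -- By Cartan's formula, `r + k + 1` is the scalar by which the Lie derivative along `X` acts on
  -- these forms.
  have hc : (r : ℝ) + (k + 1 : ℕ) ≠ 0 := by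
    have : (0 : ℝ) ≤ r := by exact_mod_cast hr
    positivity
  have h := contractPos_extDer_add ω
  have hd : extDer (0 : PolyAlt n k) = 0 := by
    refine alternating_ext_all fun I => ?_
    simp [extDer_basisTuple]
  rw [h0, hd, add_zero, euler_homForms hω, ← add_smul] at h
  refine ⟨((r : ℝ) + (k + 1 : ℕ))⁻¹ • extDer ω,
    Submodule.smul_mem _ _ (extDer_mem_homForms hω), ?_⟩
  rw [map_smul, h, smul_smul, inv_mul_cancel₀ hc, one_smul]

/-- On 0-forms the Lie derivative is the Euler operator, with eigenvalue `r`. It degenerates on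
constants, which is the source of the exception `r = k = 0`. -/
theorem exists_contractPos_eq_zero {r : ℤ} (hr : r ≠ 0) {ω : PolyAlt n 0}
    (hω : ω ∈ homForms n r 0) : ∃ α ∈ homForms n (r - 1) 1, contractPos α = ω := by
  have h := contractPos_extDer_zero ω
  rw [euler_homForms hω] at h
  refine ⟨(r : ℝ)⁻¹ • extDer ω, Submodule.smul_mem _ _ (extDer_mem_homForms hω), ?_⟩
  rw [map_smul, h, smul_smul, inv_mul_cancel₀ (by exact_mod_cast hr), one_smul]

end Homogeneous

/-! ### Evaluation at points and restriction to the simplex. -/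

section Evaluation

variable {n k m : ℕ}

theorem eval_smul_of_mem_homPoly {r : ℕ} {p : MvPolynomial (Fin (n + 1)) ℝ}
    (hp : p ∈ homPoly n r) (c : ℝ) (x : Fin (n + 1) → ℝ) :
    eval (c • x) p = c ^ r * eval x p := by
  rw [eval_eq', eval_eq', Finset.mul_sum]
  refine Finset.sum_congr rfl fun d hd => ?_
  have h1 := hp d (mem_support_iff.mp hd)
  have h2 : ∑ i, d i = r := by
    rw [← Finsupp.degree_eq_sum]
    exact_mod_cast h1
  simp only [Pi.smul_apply, smul_eq_mul, mul_pow, Finset.prod_mul_distrib,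
    Finset.prod_pow_eq_pow_sum, h2]
  ring

theorem eq_zero_of_eval_pos {p : MvPolynomial (Fin (n + 1)) ℝ}
    (h : ∀ x : Fin (n + 1) → ℝ, (∀ i, 0 < x i) → eval x p = 0) : p = 0 := by
  refine funext_set (fun _ => Set.Ioi (0 : ℝ)) (fun _ => Set.Ioi_infinite 0) fun x hx => ?_
  rw [map_zero]
  exact h x fun i => hx i (Set.mem_univ i)

theorem normalize_mem_stdSimplex {x : Fin (n + 1) → ℝ} (hx : ∀ i, 0 ≤ x i) (hs : 0 < ∑ i, x i) :
    (∑ i, x i)⁻¹ • x ∈ stdSimplex ℝ (Fin (n + 1)) := by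
  refine ⟨fun i => mul_nonneg (inv_nonneg.mpr hs.le) (hx i), ?_⟩
  simp only [Pi.smul_apply, smul_eq_mul]
  rw [← Finset.mul_sum, inv_mul_cancel₀ hs.ne']

theorem eval_eq_zero_of_stdSimplex {r : ℕ} {p : MvPolynomial (Fin (n + 1)) ℝ}
    (hp : p ∈ homPoly n r) {x : Fin (n + 1) → ℝ} (hs : 0 < ∑ i, x i)
    (h : eval ((∑ i, x i)⁻¹ • x) p = 0) : eval x p = 0 := by
  have := eval_smul_of_mem_homPoly hp (∑ i, x i) ((∑ i, x i)⁻¹ • x)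
  rwa [smul_smul, mul_inv_cancel₀ hs.ne', one_smul, h, mul_zero] at this

/-- By homogeneity the values on the positive orthant are determined by those on the simplex, and a
polynomial vanishing on the orthant is zero. -/
theorem eq_zero_of_eval_stdSimplex {r : ℤ} {p : MvPolynomial (Fin (n + 1)) ℝ}
    (hp : p ∈ homPoly n r) (h : ∀ x ∈ stdSimplex ℝ (Fin (n + 1)), eval x p = 0) : p = 0 := by
  rcases lt_or_ge r 0 with hr | hr
  · exact eq_zero_of_mem_homPoly hr hp
  lift r to ℕ using hr
  refine eq_zero_of_eval_pos fun x hx => ?_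
  have hs : 0 < ∑ i, x i := Finset.sum_pos (fun i _ => hx i) Finset.univ_nonempty
  exact eval_eq_zero_of_stdSimplex hp hs (h _ (normalize_mem_stdSimplex (fun i => (hx i).le) hs))

theorem X_dvd_sub_aeval (i : Fin (n + 1)) (p : MvPolynomial (Fin (n + 1)) ℝ) :
    X i ∣ p - aeval (Function.update X i 0) p := by
  induction p using MvPolynomial.induction_on with
  | C a => simp
  | add p q hp hq =>
    rw [map_add, add_sub_add_comm]
    exact dvd_add hp hq
  | mul_X p j hp =>
    rw [map_mul, aeval_X]
    rcases eq_or_ne j i with rfl | hj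
    · simp
    · rw [Function.update_of_ne hj, ← sub_mul]
      exact hp.mul_right _

/-- A homogeneous polynomial which vanishes on a facet of the simplex is divisible by the
corresponding coordinate. -/
theorem X_dvd_of_eval_facet {r : ℤ} {p : MvPolynomial (Fin (n + 1)) ℝ} (hp : p ∈ homPoly n r)
    (hn : n ≠ 0 ∨ r ≠ 0) (i : Fin (n + 1))
    (h : ∀ x ∈ stdSimplex ℝ (Fin (n + 1)), x i = 0 → eval x p = 0) : X i ∣ p := by
  rcases lt_or_ge r 0 with hr | hr
  · simp [eq_zero_of_mem_homPoly hr hp]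
  lift r to ℕ using hr
  have h0 : aeval (Function.update X i 0) p = (0 : MvPolynomial (Fin (n + 1)) ℝ) := by
    refine eq_zero_of_eval_pos fun x hx => ?_
    have he : eval x (aeval (Function.update X i 0) p) = eval (Function.update x i 0) p := by
      rw [← coe_aeval_eq_eval, ← coe_aeval_eq_eval]
      change (aeval x) ((aeval (Function.update X i 0)) p) = aeval (Function.update x i 0) p
      rw [← AlgHom.comp_apply]
      congr 1
      refine algHom_ext fun j => ?_
      rcases eq_or_ne j i with rfl | hj
      · simp
      · simp [Function.update_of_ne hj]
    rw [he]
    have hnn : ∀ j, 0 ≤ Function.update x i 0 j := by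
      intro j
      rcases eq_or_ne j i with rfl | hj
      · simp
      · simp [Function.update_of_ne hj, (hx j).le]
    by_cases hn0 : n = 0
    · subst hn0
      -- For `n = 0` the facet is empty and gives no information; the only point to treat is the
      -- origin, where positive degree forces the value zero.
      have hz : Function.update x i 0 = (0 : ℝ) • x := by
        ext j
        rw [show j = i from Fin.ext (by omega)]
        simp
      rw [hz, eval_smul_of_mem_homPoly hp, zero_pow (by simpa using hn), zero_mul]
    · obtain ⟨j, hj⟩ : ∃ j, j ≠ i :=
        haveI : Nontrivial (Fin (n + 1)) := Fin.nontrivial_iff_two_le.mpr (by omega)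
        exists_ne i
      have hs : 0 < ∑ j, Function.update x i 0 j :=
        Finset.sum_pos' (fun j _ => hnn j) ⟨j, Finset.mem_univ _, by simp [hj, hx]⟩
      exact eval_eq_zero_of_stdSimplex hp hs
        (h _ (normalize_mem_stdSimplex hnn hs) (by simp))
  have hd := X_dvd_sub_aeval i p
  rwa [h0, sub_zero] at hd

/-- The value of a form with polynomial coefficients at a point. -/
noncomputable def evalForm (x : Fin (n + 1) → ℝ) :
    PolyAlt n k →ₗ[ℝ] (Fin (n + 1) → ℝ) [⋀^Fin k]→ₗ[ℝ] ℝ where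
  toFun ω := (aeval x).toLinearMap.compAlternatingMap ω
  map_add' ω η := by ext; simp
  map_smul' c ω := by ext; simp

theorem evalForm_apply (x : Fin (n + 1) → ℝ) (ω : PolyAlt n k) (v : Fin k → Fin (n + 1) → ℝ) :
    evalForm x ω v = eval x (ω v) := by
  rw [← coe_aeval_eq_eval]
  rfl

theorem evalForm_wedgeSum (x : Fin (n + 1) → ℝ) (ω : PolyAlt n k) :
    evalForm x (wedgeSum ω) = wedgeSum (evalForm x ω) := by
  ext v
  rw [evalForm_apply, wedge_apply, wedge_apply, map_sum]
  refine Finset.sum_congr rfl fun a _ => ?_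
  rw [evalForm_apply]
  simp
  ring

theorem evalForm_contractPos (x : Fin (n + 1) → ℝ) (ω : PolyAlt n (k + 1)) :
    evalForm x (contractPos ω) = (evalForm x ω).curryLeft x := by
  have hx : x = ∑ j, x j • Pi.single j (1 : ℝ) := by
    ext i
    simp [Finset.sum_apply, Pi.single_apply]
  conv_rhs => rw [hx, map_sum]
  refine alternating_ext_all fun J => ?_
  rw [evalForm_apply, contractPos_basisTuple, map_sum, alternating_sum_apply]
  refine Finset.sum_congr rfl fun j _ => ?_
  rw [map_smul, AlternatingMap.smul_apply, AlternatingMap.curryLeft_apply_apply,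
    vecCons_basisTuple, ← hx, evalForm_apply]
  simp

theorem ext_evalForm {ω η : PolyAlt n k} (h : ∀ x, evalForm x ω = evalForm x η) : ω = η := by
  refine alternating_ext_all fun I => MvPolynomial.funext fun x => ?_
  rw [← evalForm_apply, ← evalForm_apply, h]

theorem contractPos_contractPos (ω : PolyAlt n (k + 2)) : contractPos (contractPos ω) = 0 :=
  ext_evalForm fun x => by
    rw [evalForm_contractPos, evalForm_contractPos, AlternatingMap.curryLeft_same, map_zero]

theorem eq_zero_of_evalForm_stdSimplex {r : ℤ} {ω : PolyAlt n k} (hω : ω ∈ homForms n r k)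
    (h : ∀ x ∈ stdSimplex ℝ (Fin (n + 1)), evalForm x ω = 0) : ω = 0 :=
  alternating_ext_all fun I => eq_zero_of_eval_stdSimplex (hω I) fun x hx => by
    rw [← evalForm_apply, h x hx, AlternatingMap.zero_apply]

/-- The form on `ℝⁿ⁺¹` given by a form with polynomial coefficients. -/
noncomputable def toForm : PolyAlt n k →ₗ[ℝ] Form n k := LinearMap.pi evalForm

/-- The form on the simplex given by a form with polynomial coefficients. -/
noncomputable def toSimplexForm : PolyAlt n k →ₗ[ℝ] SimplexForm n k := restrict n k ∘ₗ toForm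

theorem toSimplexForm_apply (ω : PolyAlt n k) (x : stdSimplex ℝ (Fin (n + 1)))
    (v : Fin k → tangent n) : toSimplexForm ω x v = evalForm x.1 ω fun a => (v a).1 := rfl

theorem toSimplexForm_eq_zero_iff (ω : PolyAlt n k) :
    toSimplexForm ω = 0 ↔ ∀ x ∈ stdSimplex ℝ (Fin (n + 1)), ∀ w : Fin k → Fin (n + 1) → ℝ,
      (∀ a, sumForm n (w a) = 0) → evalForm x ω w = 0 := by
  constructor
  · intro h x hx w hw
    have h1 := DFunLike.congr_fun (congrFun h ⟨x, hx⟩) fun a => ⟨w a, by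
      have := hw a
      rw [sumForm_apply] at this
      exact this⟩
    exact h1
  · intro h
    funext x
    ext v
    rw [toSimplexForm_apply]
    exact h x.1 x.2 _ fun a => by rw [sumForm_apply]; exact (v a).2

/-- The tangent space is the kernel of `s`, so `wedge_eq_zero_iff` applies at each point;
homogeneity extends the vanishing of `s ∧ ω` from the simplex to all of `ℝⁿ⁺¹`. -/
theorem toSimplexForm_eq_zero_iff_wedgeSum {r : ℤ} {ω : PolyAlt n k} (hω : ω ∈ homForms n r k) :
    toSimplexForm ω = 0 ↔ wedgeSum ω = 0 := by
  have hiff : ∀ x, wedgeSum (evalForm x ω) = 0 ↔ ∀ w : Fin k → Fin (n + 1) → ℝ,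
      (∀ a, sumForm n (w a) = 0) → evalForm x ω w = 0 := fun x =>
    wedge_eq_zero_iff (v := Pi.single 0 1) (by simp) _
  rw [toSimplexForm_eq_zero_iff]
  constructor
  · intro h
    refine eq_zero_of_evalForm_stdSimplex (wedgeSum_mem_homForms hω) fun x hx => ?_
    rw [evalForm_wedgeSum, hiff]
    exact h x hx
  · intro h x _
    rw [← hiff, ← evalForm_wedgeSum, h, map_zero]

/-- At a point `x` of the simplex, `x` is transversal to the tangent space and annihilates `i_X ω`,
which is therefore determined by its restriction. -/
theorem toSimplexForm_contractPos_eq_zero_iff {r : ℤ} {ω : PolyAlt n (k + 1)}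
    (hω : ω ∈ homForms n r (k + 1)) :
    toSimplexForm (contractPos ω) = 0 ↔ contractPos ω = 0 := by
  refine ⟨fun h => ?_, fun h => by rw [h, map_zero]⟩
  rw [toSimplexForm_eq_zero_iff] at h
  refine eq_zero_of_evalForm_stdSimplex (contractPos_mem_homForms rfl hω) fun x hx => ?_
  cases k with
  | zero =>
    ext w
    exact h x hx w fun a => a.elim0
  | succ k =>
    refine eq_zero_of_curryLeft_of_ker (f := sumForm n) (v := x) ?_ ?_ (h x hx)
    · rw [sumForm_apply, hx.2]
    · rw [evalForm_contractPos, AlternatingMap.curryLeft_same]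

end Evaluation

/-! ### Vanishing traces on the facets as divisibility of coefficients. -/

section Trace

variable {n k : ℕ}

/-- The projection onto the `i`-th coordinate hyperplane. -/
noncomputable def dropCoord (i : Fin (n + 1)) : (Fin (n + 1) → ℝ) →ₗ[ℝ] (Fin (n + 1) → ℝ) :=
  LinearMap.id - (LinearMap.proj i).smulRight (Pi.single i 1)

theorem dropCoord_self (i : Fin (n + 1)) (v : Fin (n + 1) → ℝ) : dropCoord i v i = 0 := by
  simp [dropCoord]

theorem dropCoord_of_eq_zero {i : Fin (n + 1)} {v : Fin (n + 1) → ℝ} (h : v i = 0) :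
    dropCoord i v = v := by
  simp [dropCoord, h]

theorem dropCoord_single_self (i : Fin (n + 1)) : dropCoord i (Pi.single i 1) = 0 := by
  simp [dropCoord]

/-- Pulling back along `dropCoord i` expresses facet-tangency by the kernel of a single linear form
on `ℝⁿ⁺¹`, so the transversality lemmas apply to facets as well. -/
theorem toSimplexForm_mem_zeroTrace_iff (ω : PolyAlt n k) :
    toSimplexForm ω ∈ zeroTrace n k ↔ ∀ i, ∀ x ∈ stdSimplex ℝ (Fin (n + 1)), x i = 0 →
      ∀ w : Fin k → Fin (n + 1) → ℝ, (∀ a, (sumForm n ∘ₗ dropCoord i) (w a) = 0) →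
        (evalForm x ω).compLinearMap (dropCoord i) w = 0 := by
  simp only [zeroTrace, Submodule.mem_iInf, LinearMap.mem_ker]
  refine forall_congr' fun i => ?_
  constructor
  · intro h x hx hxi w hw
    have h1 := DFunLike.congr_fun (congrFun h ⟨⟨x, hx⟩, hxi⟩) fun a => ⟨⟨dropCoord i (w a), by
      have := hw a
      rw [LinearMap.comp_apply, sumForm_apply] at this
      exact this⟩, dropCoord_self i (w a)⟩
    exact h1
  · intro h
    funext x
    ext v
    have hv : ∀ a, dropCoord i (v a).1.1 = (v a).1.1 := fun a => dropCoord_of_eq_zero (v a).2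
    have h1 := h x.1.1 x.1.2 x.2 (fun a => (v a).1.1) fun a => by
      rw [LinearMap.comp_apply, hv, sumForm_apply]
      exact (v a).1.2
    rw [AlternatingMap.compLinearMap_apply] at h1
    simp only [hv] at h1
    exact h1

theorem compLinearMap_dropCoord_of_mem_vanishing {ω : PolyAlt n k} (hω : ω ∈ vanishing n k)
    {i : Fin (n + 1)} {x : Fin (n + 1) → ℝ} (hx : x i = 0) :
    (evalForm x ω).compLinearMap (dropCoord i) = 0 := by
  refine alternating_ext_all fun J => ?_
  rw [AlternatingMap.compLinearMap_apply, AlternatingMap.zero_apply]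
  by_cases hJ : ∃ a, J a = i
  · obtain ⟨a, ha⟩ := hJ
    refine AlternatingMap.map_coord_zero _ a ?_
    rw [basisTuple, ha, dropCoord_single_self]
  · push Not at hJ
    have : (fun a => dropCoord i (basisTuple J a)) = basisTuple J := by
      ext a : 1
      exact dropCoord_of_eq_zero (by simp [(hJ a).symm])
    rw [this, evalForm_apply]
    obtain ⟨q, hq⟩ := hω i J hJ
    rw [hq, map_mul, eval_X, hx, zero_mul]

theorem mem_vanishing_of_compLinearMap_dropCoord {r : ℤ} {ω : PolyAlt n k}
    (hω : ω ∈ homForms n r k) (hn : n ≠ 0 ∨ r ≠ 0)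
    (h : ∀ i, ∀ x ∈ stdSimplex ℝ (Fin (n + 1)), x i = 0 →
      (evalForm x ω).compLinearMap (dropCoord i) = 0) : ω ∈ vanishing n k := by
  intro i J hJ
  refine X_dvd_of_eval_facet (hω J) hn i fun x hx hxi => ?_
  have := DFunLike.congr_fun (h i x hx hxi) (basisTuple J)
  rw [AlternatingMap.compLinearMap_apply] at this
  have h1 : (fun a => dropCoord i (basisTuple J a)) = basisTuple J := by
    ext a : 1
    exact dropCoord_of_eq_zero (by simp [(hJ a).symm])
  rwa [h1, evalForm_apply] at this

theorem sumForm_dropCoord {i : Fin (n + 1)} {x : Fin (n + 1) → ℝ}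
    (hx : x ∈ stdSimplex ℝ (Fin (n + 1))) (hxi : x i = 0) :
    (sumForm n ∘ₗ dropCoord i) x = 1 := by
  rw [LinearMap.comp_apply, dropCoord_of_eq_zero hxi, sumForm_apply, hx.2]

theorem toSimplexForm_mem_zeroTrace_of_mem_vanishing {ω : PolyAlt n k} (hω : ω ∈ vanishing n k) :
    toSimplexForm ω ∈ zeroTrace n k := by
  rw [toSimplexForm_mem_zeroTrace_iff]
  intro i x _ hxi w _
  rw [compLinearMap_dropCoord_of_mem_vanishing hω hxi, AlternatingMap.zero_apply]

/-- At a point of a facet the position vector lies in the hyperplane of that facet, is transversal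
to the facet and annihilates `i_X ω`; so a zero trace on the facet is a zero trace on the
hyperplane. -/
theorem contractPos_mem_vanishing {r : ℤ} {ω : PolyAlt n (k + 1)}
    (hω : ω ∈ homForms n r (k + 1)) (h : toSimplexForm (contractPos ω) ∈ zeroTrace n k) :
    contractPos ω ∈ vanishing n k := by
  rcases lt_or_ge r 0 with hr | hr
  · rw [eq_zero_of_mem_homForms hr hω, map_zero]
    exact Submodule.zero_mem _
  rw [toSimplexForm_mem_zeroTrace_iff] at h
  refine mem_vanishing_of_compLinearMap_dropCoord (contractPos_mem_homForms rfl hω)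
    (.inr (by omega)) fun i x hx hxi => ?_
  cases k with
  | zero =>
    ext w
    exact h i x hx hxi w fun a => a.elim0
  | succ k =>
    refine eq_zero_of_curryLeft_of_ker (sumForm_dropCoord hx hxi) ?_ (h i x hx hxi)
    rw [AlternatingMap.curryLeft_compLinearMap, dropCoord_of_eq_zero hxi, evalForm_contractPos,
      AlternatingMap.curryLeft_same, AlternatingMap.zero_compLinearMap]

theorem toSimplexForm_mem_zeroTrace_iff_wedgeSum {r : ℤ} {ω : PolyAlt n k}
    (hω : ω ∈ homForms n r k) :
    toSimplexForm ω ∈ zeroTrace n k ↔ wedgeSum ω ∈ vanishing n (k + 1) := by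
  have hiff : ∀ i, ∀ x ∈ stdSimplex ℝ (Fin (n + 1)), x i = 0 →
      ((evalForm x (wedgeSum ω)).compLinearMap (dropCoord i) = 0 ↔
      ∀ w : Fin k → Fin (n + 1) → ℝ, (∀ a, (sumForm n ∘ₗ dropCoord i) (w a) = 0) →
        (evalForm x ω).compLinearMap (dropCoord i) w = 0) := fun i x hx hxi => by
    rw [evalForm_wedgeSum, wedge_compLinearMap, wedge_eq_zero_iff (sumForm_dropCoord hx hxi)]
  rw [toSimplexForm_mem_zeroTrace_iff]
  constructor
  · intro h
    -- For `n = 0` there are no facet points, but membership in `vanishing` is void too: a nonempty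
    -- tuple in `Fin 1` contains `i`.
    by_cases hn : n = 0
    · subst hn
      intro i J hJ
      exact absurd (Fin.ext (by omega)) (hJ 0)
    · exact mem_vanishing_of_compLinearMap_dropCoord (wedgeSum_mem_homForms hω) (.inl hn)
        fun i x hx hxi => (hiff i x hx hxi).mpr (h i x hx hxi)
  · intro h i x hx hxi
    exact (hiff i x hx hxi).mp (compLinearMap_dropCoord_of_mem_vanishing h hxi)

end Trace

/-! ### The spaces on the simplex as images of homogeneous forms. -/

section Spaces

variable {n k : ℕ}

/-- The component of degree `i` is multiplied by `(∑ X j) ^ (r - i)`, which is `1` on the simplex.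
Linearity of `L` is what later preserves the antisymmetry of coefficients. -/
theorem exists_homogenize (n : ℕ) (r : ℤ) : ∃ L : MvPolynomial (Fin (n + 1)) ℝ →ₗ[ℝ]
    MvPolynomial (Fin (n + 1)) ℝ, ∀ p ∈ polyLE n r, L p ∈ homPoly n r ∧
      ∀ x ∈ stdSimplex ℝ (Fin (n + 1)), eval x (L p) = eval x p := by
  rcases lt_or_ge r 0 with hr | hr
  · refine ⟨0, fun p hp => ⟨Submodule.zero_mem _, ?_⟩⟩
    rcases hp with rfl | hp
    · simp
    · omega
  lift r to ℕ using hr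
  refine ⟨∑ i ∈ Finset.range (r + 1),
    LinearMap.mulLeft ℝ ((∑ j, X j) ^ (r - i)) ∘ₗ homogeneousComponent i, fun p hp => ⟨?_, ?_⟩⟩
  · rw [LinearMap.sum_apply]
    refine Submodule.sum_mem _ fun i hi => mem_homPoly_natCast.mpr ?_
    have hi : i ≤ r := by simpa [Nat.lt_succ_iff] using hi
    have h1 : ((∑ j, X j : MvPolynomial (Fin (n + 1)) ℝ) ^ (r - i)).IsHomogeneous (r - i) := by
      simpa using (IsHomogeneous.sum _ _ 1 fun j _ => isHomogeneous_X ℝ j).pow (r - i)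
    have h2 := h1.mul (homogeneousComponent_isHomogeneous i p)
    rwa [Nat.sub_add_cancel hi] at h2
  · intro x hx
    have hd : p.totalDegree ≤ r := by
      rcases hp with rfl | hp
      · simp
      · exact_mod_cast hp
    have hp' : ∑ i ∈ Finset.range (r + 1), homogeneousComponent i p = p := by
      conv_rhs => rw [← sum_homogeneousComponent p]
      refine (Finset.sum_subset (Finset.range_subset_range.mpr (by omega)) fun i _ hi => ?_).symm
      exact homogeneousComponent_eq_zero _ _ (by simpa [Nat.lt_succ_iff] using hi)
    conv_rhs => rw [← hp', map_sum]
    rw [LinearMap.sum_apply, map_sum]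
    refine Finset.sum_congr rfl fun i _ => ?_
    simp [hx.2]

theorem homPoly_le_polyLE (n : ℕ) (r : ℤ) : homPoly n r ≤ polyLE n r := by
  intro p hp
  rcases lt_or_ge r 0 with hr | hr
  · exact Or.inl (eq_zero_of_mem_homPoly hr hp)
  lift r to ℕ using hr
  exact Or.inr (by exact_mod_cast (mem_homPoly_natCast.mp hp).totalDegree_le)

theorem toForm_mem_polyForms {r : ℤ} {ω : PolyAlt n k} (hω : ω ∈ homForms n r k) :
    toForm ω ∈ polyForms n r k := fun I =>
  ⟨ω (basisTuple I), homPoly_le_polyLE n r (hω I), fun x => evalForm_apply x ω _⟩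

/-- Every polynomial form agrees on the simplex with a homogeneous one. -/
theorem exists_homForms_eq {r : ℤ} {ω : Form n k} (hω : ω ∈ polyForms n r k) :
    ∃ α ∈ homForms n r k, ∀ x ∈ stdSimplex ℝ (Fin (n + 1)), evalForm x α = ω x := by
  choose p hp hpx using hω
  obtain ⟨L, hL⟩ := exists_homogenize n r
  have hc : ∀ I a b, a ≠ b → L (p (I ∘ Equiv.swap a b)) = -L (p I) := by
    intro I a b hab
    rw [← map_neg]
    congr 1
    refine MvPolynomial.funext fun x => ?_
    rw [map_neg, ← hpx, ← hpx]
    exact (ω x).map_swap (basisTuple I) hab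
  refine ⟨ofCoeff (fun I => L (p I)) hc, fun I => ?_, fun x hx => alternating_ext_all fun I => ?_⟩
  · rw [ofCoeff_apply]
    exact (hL _ (hp I)).1
  · rw [evalForm_apply, ofCoeff_apply, (hL _ (hp I)).2 x hx, ← hpx]

theorem restrict_eq_toSimplexForm {ω : Form n k} {α : PolyAlt n k}
    (h : ∀ x ∈ stdSimplex ℝ (Fin (n + 1)), evalForm x α = ω x) :
    restrict n k ω = toSimplexForm α := by
  funext x
  change _ = (evalForm x.1 α).compLinearMap (tangent n).subtype
  rw [h x.1 x.2]
  rfl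

theorem contraction_toForm (α : PolyAlt n (k + 1)) :
    contraction n k (toForm α) = toForm (contractPos α) :=
  funext fun x => (evalForm_contractPos x α).symm

theorem mem_P_iff {r : ℤ} {ω : SimplexForm n k} :
    ω ∈ P n r k ↔ ∃ α ∈ homForms n r k, toSimplexForm α = ω := by
  constructor
  · rintro ⟨ω, hω, rfl⟩
    obtain ⟨α, hα, h⟩ := exists_homForms_eq hω
    exact ⟨α, hα, (restrict_eq_toSimplexForm h).symm⟩
  · rintro ⟨α, hα, rfl⟩
    exact ⟨_, toForm_mem_polyForms hα, rfl⟩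

theorem mem_Pminus_iff {r : ℤ} {ω : SimplexForm n k} :
    ω ∈ Pminus n r k ↔
      ∃ α ∈ homForms n (r - 1) (k + 1), toSimplexForm (contractPos α) = ω := by
  constructor
  · rintro ⟨_, ⟨ω, hω, rfl⟩, rfl⟩
    obtain ⟨α, hα, h⟩ := exists_homForms_eq hω
    refine ⟨α, hα, (restrict_eq_toSimplexForm fun x hx => ?_).symm⟩
    rw [evalForm_contractPos, h x hx]
    rfl
  · rintro ⟨α, hα, rfl⟩
    refine ⟨_, ⟨_, toForm_mem_polyForms hα, rfl⟩, ?_⟩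
    rw [contraction_toForm]
    rfl

end Spaces

/-! ### Equivariance under permutations of the coordinates. -/

section Permutations

variable {n k m : ℕ}

/-- The pullback of a form with polynomial coefficients by a permutation of the coordinates. -/
noncomputable def permAct (π : Equiv.Perm (Fin (n + 1))) (ω : PolyAlt n k) : PolyAlt n k :=
  (rename π).toLinearMap.compAlternatingMap (ω.compLinearMap (permMap n π))

theorem permMap_basisTuple (π : Equiv.Perm (Fin (n + 1))) (I : Fin k → Fin (n + 1)) :
    (fun a => permMap n π (basisTuple I a)) = basisTuple fun a => π.symm (I a) := by
  ext a l
  simp [permMap, LinearMap.funLeft_apply, Pi.single_apply, Equiv.eq_symm_apply]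

theorem permAct_basisTuple (π : Equiv.Perm (Fin (n + 1))) (ω : PolyAlt n k)
    (I : Fin k → Fin (n + 1)) :
    permAct π ω (basisTuple I) = rename π (ω (basisTuple fun a => π.symm (I a))) := by
  rw [← permMap_basisTuple]
  rfl

theorem permAct_mem_homForms {r : ℤ} (π : Equiv.Perm (Fin (n + 1))) {ω : PolyAlt n k}
    (hω : ω ∈ homForms n r k) : permAct π ω ∈ homForms n r k := by
  intro I
  rw [permAct_basisTuple]
  have h := hω fun a => π.symm (I a)
  rcases lt_or_ge r 0 with hr | hr
  · rw [eq_zero_of_mem_homPoly hr h, map_zero]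
    exact Submodule.zero_mem _
  lift r to ℕ using hr
  exact mem_homPoly_natCast.mpr (mem_homPoly_natCast.mp h).rename_isHomogeneous

theorem toForm_permAct (π : Equiv.Perm (Fin (n + 1))) (ω : PolyAlt n k) :
    toForm (permAct π ω) = pullbackForm n k π (toForm ω) := by
  funext x
  refine alternating_ext_all fun I => ?_
  change evalForm x (permAct π ω) (basisTuple I) =
    evalForm (permMap n π x) ω (fun a => permMap n π (basisTuple I a))
  rw [permMap_basisTuple, evalForm_apply, evalForm_apply, permAct_basisTuple, eval_rename]
  rfl

theorem toSimplexForm_permAct (π : Equiv.Perm (Fin (n + 1))) (ω : PolyAlt n k) :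
    toSimplexForm (permAct π ω) = rep n k π (toSimplexForm ω) := by
  change restrict n k (toForm (permAct π ω)) = _
  rw [toForm_permAct]
  rfl

theorem toForm_injective : Function.Injective (toForm (n := n) (k := k)) :=
  fun _ _ h => ext_evalForm fun x => congrFun h x

theorem contractPos_permAct (π : Equiv.Perm (Fin (n + 1))) (ω : PolyAlt n (k + 1)) :
    contractPos (permAct π ω) = permAct π (contractPos ω) := by
  apply toForm_injective
  rw [toForm_permAct, ← contraction_toForm, ← contraction_toForm, contraction_pullbackForm,
    toForm_permAct]

/-- Monomials and coefficients are carried along by `π`; only the orientation `bijSign` changes, by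
the sign of `π`. This produces the twist by the sign representation. -/
theorem star_permAct (h : k + m = n + 1) (π : Equiv.Perm (Fin (n + 1))) (ω : PolyAlt n k) :
    star h (permAct π ω) = Equiv.Perm.sign π • permAct π (star h ω) := by
  refine alternating_ext fun J hJ => ?_
  obtain ⟨e, he⟩ := exists_equiv_inr h hJ
  rw [star_apply h _ e (fun _ => rfl) he, AlternatingMap.smul_apply, permAct_basisTuple,
    permAct_basisTuple,
    star_apply h ω (e.trans π.symm) (I := fun a => π.symm (e (.inl a))) (fun _ => rfl)
      (by simp [he]),
    bijSign_trans, Equiv.Perm.sign_symm]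
  simp only [Units.smul_def, Units.val_mul, map_zsmul, map_mul, map_prod, rename_X,
    Equiv.apply_symm_apply, smul_smul]
  rw [← mul_assoc, ← Units.val_mul, Int.units_mul_self, Units.val_one, one_mul]

end Permutations

/-! ### The two isomorphisms and the exceptional case. -/

section Isomorphisms

theorem map_units_smul {M M' : Type*} [AddCommGroup M] [Module ℝ M] [AddCommGroup M']
    [Module ℝ M'] (L : M →ₗ[ℝ] M') (u : ℤˣ) (x : M) : L (u • x) = u • L x := by
  rcases Int.units_eq_one_or u with rfl | rfl <;> simp [Units.smul_def]

/-- Two representations which are images of the same space by linear maps with the same kernel,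
equivariant up to the sign character, are isomorphic up to a twist by the sign representation. -/
theorem nonempty_equiv_tprod_signRep {n : ℕ} {M A B : Type*} [AddCommGroup M] [Module ℝ M]
    [AddCommGroup A] [Module ℝ A] [AddCommGroup B] [Module ℝ B]
    (ρ : Representation ℝ (Equiv.Perm (Fin (n + 1))) A)
    (σ : Representation ℝ (Equiv.Perm (Fin (n + 1))) B) (f : M →ₗ[ℝ] A) (g : M →ₗ[ℝ] B)
    (hf : Function.Surjective f) (hg : Function.Surjective g) (hker : ∀ x, f x = 0 ↔ g x = 0)
    (hequiv : ∀ π x, ∃ y, f y = ρ π (f x) ∧ g y = Equiv.Perm.sign π • σ π (g x)) :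
    Nonempty (ρ.Equiv (σ.tprod (signRep n))) := by
  have hk : LinearMap.ker f = LinearMap.ker g := by
    ext x
    exact hker x
  let e : A ≃ₗ[ℝ] B := (f.quotKerEquivOfSurjective hf).symm ≪≫ₗ
    Submodule.quotEquivOfEq _ _ hk ≪≫ₗ g.quotKerEquivOfSurjective hg
  have he : ∀ x, e (f x) = g x := by
    intro x
    have : (f.quotKerEquivOfSurjective hf).symm (f x) = Submodule.Quotient.mk x := by
      rw [LinearEquiv.symm_apply_eq]
      rfl
    simp only [e, LinearEquiv.trans_apply, this, Submodule.quotEquivOfEq_mk]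
    rfl
  refine ⟨Representation.Equiv.mk (e ≪≫ₗ (TensorProduct.rid ℝ B).symm) fun π => ?_⟩
  ext a
  obtain ⟨x, rfl⟩ := hf a
  obtain ⟨y, hy1, hy2⟩ := hequiv π x
  simp only [LinearMap.comp_apply, LinearEquiv.coe_coe, LinearEquiv.trans_apply, ← hy1, he, hy2,
    TensorProduct.rid_symm_apply, Representation.tprod_apply, TensorProduct.map_tmul]
  change _ = _ ⊗ₜ[ℝ] (((Equiv.Perm.sign π : ℤ) : ℝ) • (1 : ℝ))
  rw [← TensorProduct.smul_tmul, Units.smul_def, Int.cast_smul_eq_zsmul]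

variable {n k m : ℕ}

theorem nonempty_repP_equiv (h : k + m = n) (r : ℤ) :
    Nonempty ((repP n r k).Equiv ((repPminus0 n (r + k + 1) m).tprod (signRep n))) := by
  have h1 : k + 1 + m = n + 1 := by omega
  have h2 : k + (m + 1) = n + 1 := by omega
  have hstar : ∀ ω ∈ homForms n r k, star h2 ω ∈ homForms n (r + k + 1 - 1) (m + 1) :=
    fun ω hω => (star_mem_homForms h2 (by omega)).mpr hω
  have hmem : ∀ ω : homForms n r k,
      toSimplexForm (contractPos (star h2 ω.1)) ∈ Pminus0 n (r + k + 1) m := fun ω => by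
    refine ⟨mem_Pminus_iff.mpr ⟨_, hstar ω ω.2, rfl⟩,
      toSimplexForm_mem_zeroTrace_of_mem_vanishing ?_⟩
    rw [contractPos_star h1 h2, units_smul_mem]
    exact star_mem_vanishing h1 _
  refine nonempty_equiv_tprod_signRep (M := homForms n r k) (A := P n r k)
    (B := Pminus0 n (r + k + 1) m) _ _
    ((toSimplexForm ∘ₗ (homForms n r k).subtype).codRestrict (P n r k)
      fun ω => mem_P_iff.mpr ⟨ω, ω.2, rfl⟩)
    ((toSimplexForm ∘ₗ contractPos ∘ₗ star h2 ∘ₗ (homForms n r k).subtype).codRestrict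
      (Pminus0 n (r + k + 1) m) hmem) ?_ ?_ ?_ ?_
  · rintro ⟨b, hb⟩
    obtain ⟨α, hα, rfl⟩ := mem_P_iff.mp hb
    exact ⟨⟨α, hα⟩, rfl⟩
  · rintro ⟨b, hb, hb0⟩
    obtain ⟨β, hβ, rfl⟩ := mem_Pminus_iff.mp hb
    obtain ⟨η, hη⟩ := exists_star_eq h1 (contractPos_mem_vanishing hβ hb0)
    have hηr : η ∈ homForms n r (k + 1) := by
      refine (star_mem_homForms h1 (s := r + k + 1) (by push_cast; ring)).mp ?_
      rw [hη]
      exact contractPos_mem_homForms (by ring) hβ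
    -- For `m > 0` this is `i_X i_X = 0` seen through the star; for `m = 0` the form `s ∧ η` has
    -- degree `n + 2`.
    have hη0 : wedgeSum η = 0 := by
      cases m with
      | zero => exact eq_zero_of_card_lt (by omega) _
      | succ m =>
        have := contractPos_star (by omega) h1 η
        rwa [hη, contractPos_contractPos, eq_comm, smul_eq_zero_iff_eq,
          (star_injective _).eq_iff' (map_zero _)] at this
    -- Contraction with the first coordinate vector, on which `s` is `1`, gives a primitive of `η`
    -- for `s ∧ ·`.
    refine ⟨⟨shiftSign h1 • η.curryLeft (Pi.single 0 1),
      (units_smul_mem _).mpr (curryLeft_mem_homForms hηr 0)⟩, Subtype.ext ?_⟩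
    change toSimplexForm (contractPos (star h2 (shiftSign h1 • η.curryLeft (Pi.single 0 1)))) = _
    rw [map_units_smul, map_units_smul, contractPos_star h1 h2,
      ← eq_wedgeSum_of_wedgeSum_eq_zero hη0, hη, smul_smul, Int.units_mul_self, one_smul]
  · intro ω
    rw [← Subtype.coe_inj, ← Subtype.coe_inj]
    change toSimplexForm ω.1 = 0 ↔ toSimplexForm (contractPos (star h2 ω.1)) = 0
    rw [toSimplexForm_contractPos_eq_zero_iff (hstar ω ω.2), contractPos_star h1 h2,
      smul_eq_zero_iff_eq, (star_injective h1).eq_iff' (map_zero _),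
      toSimplexForm_eq_zero_iff_wedgeSum ω.2]
  · intro π ω
    refine ⟨⟨permAct π ω.1, permAct_mem_homForms π ω.2⟩, Subtype.ext ?_, Subtype.ext ?_⟩
    · exact toSimplexForm_permAct π ω.1
    · refine Eq.trans ?_ (map_units_smul (Submodule.subtype _) _ _).symm
      change toSimplexForm (contractPos (star h2 (permAct π ω.1))) =
        Equiv.Perm.sign π • rep n m π (toSimplexForm (contractPos (star h2 ω.1)))
      rw [star_permAct, map_units_smul, map_units_smul, contractPos_permAct,
        toSimplexForm_permAct]

theorem nonempty_repPminus_equiv (h : k + m = n) {r : ℤ} (hrk : ¬(r = 0 ∧ k = 0)) :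
    Nonempty ((repPminus n r k).Equiv ((repP0 n (r + k) m).tprod (signRep n))) := by
  have h1 : k + 1 + m = n + 1 := by omega
  have h2 : k + (m + 1) = n + 1 := by omega
  have hstar : ∀ α ∈ homForms n (r - 1) (k + 1), star h1 α ∈ homForms n (r + k) m :=
    fun α hα => (star_mem_homForms h1 (by push_cast; ring)).mpr hα
  have hmem : ∀ α : homForms n (r - 1) (k + 1),
      toSimplexForm (star h1 α.1) ∈ P0 n (r + k) m := fun α => by
    refine ⟨mem_P_iff.mpr ⟨_, hstar α α.2, rfl⟩,
      (toSimplexForm_mem_zeroTrace_iff_wedgeSum (hstar α α.2)).mpr ?_⟩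
    rw [wedgeSum_star h1 h2, units_smul_mem]
    exact star_mem_vanishing h2 _
  refine nonempty_equiv_tprod_signRep (M := homForms n (r - 1) (k + 1)) (A := Pminus n r k)
    (B := P0 n (r + k) m) _ _
    ((toSimplexForm ∘ₗ contractPos ∘ₗ (homForms n (r - 1) (k + 1)).subtype).codRestrict
      (Pminus n r k) fun α => mem_Pminus_iff.mpr ⟨α, α.2, rfl⟩)
    ((toSimplexForm ∘ₗ star h1 ∘ₗ (homForms n (r - 1) (k + 1)).subtype).codRestrict
      (P0 n (r + k) m) hmem) ?_ ?_ ?_ ?_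
  · rintro ⟨b, hb⟩
    obtain ⟨α, hα, rfl⟩ := mem_Pminus_iff.mp hb
    exact ⟨⟨α, hα⟩, rfl⟩
  · rintro ⟨b, hb, hb0⟩
    obtain ⟨ω, hω, rfl⟩ := mem_P_iff.mp hb
    obtain ⟨ζ, hζ⟩ :=
      exists_star_eq h2 ((toSimplexForm_mem_zeroTrace_iff_wedgeSum hω).mp hb0)
    have hζr : ζ ∈ homForms n r k := by
      refine (star_mem_homForms h2 rfl).mp ?_
      rw [hζ]
      exact wedgeSum_mem_homForms hω
    -- `s ∧ s = 0` makes `ζ` closed for `i_X` when `k > 0`; Koszul exactness then supplies `α`. Only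
    -- for `k = 0` is `r ≠ 0` needed.
    obtain ⟨α, hα, rfl⟩ : ∃ α ∈ homForms n (r - 1) (k + 1), contractPos α = ζ := by
      cases k with
      | zero => exact exists_contractPos_eq_zero (by simpa using hrk) hζr
      | succ k =>
        refine exists_contractPos_eq_succ hζr ?_
        have := wedgeSum_star h2 (by omega) ζ
        rwa [hζ, wedge_wedge, eq_comm, smul_eq_zero_iff_eq,
          (star_injective _).eq_iff' (map_zero _)] at this
    refine ⟨⟨shiftSign h1 • α, (units_smul_mem _).mpr hα⟩, Subtype.ext ?_⟩
    change toSimplexForm (star h1 (shiftSign h1 • α)) = toSimplexForm ω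
    -- The star of the witness need not equal `ω`; it suffices that their difference is killed by `s
    -- ∧ ·`.
    rw [← sub_eq_zero, ← map_sub, toSimplexForm_eq_zero_iff_wedgeSum (Submodule.sub_mem _
      (hstar _ ((units_smul_mem _).mpr hα)) hω), map_sub, map_units_smul, map_units_smul,
      wedgeSum_star h1 h2, hζ, smul_smul, Int.units_mul_self, one_smul, sub_self]
  · intro α
    rw [← Subtype.coe_inj, ← Subtype.coe_inj]
    change toSimplexForm (contractPos α.1) = 0 ↔ toSimplexForm (star h1 α.1) = 0
    rw [toSimplexForm_eq_zero_iff_wedgeSum (hstar α α.2), wedgeSum_star h1 h2,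
      smul_eq_zero_iff_eq, (star_injective h2).eq_iff' (map_zero _),
      toSimplexForm_contractPos_eq_zero_iff α.2]
  · intro π α
    refine ⟨⟨permAct π α.1, permAct_mem_homForms π α.2⟩, Subtype.ext ?_, Subtype.ext ?_⟩
    · change toSimplexForm (contractPos (permAct π α.1)) =
        rep n k π (toSimplexForm (contractPos α.1))
      rw [contractPos_permAct, toSimplexForm_permAct]
    · refine Eq.trans ?_ (map_units_smul (Submodule.subtype _) _ _).symm
      change toSimplexForm (star h1 (permAct π α.1)) =
        Equiv.Perm.sign π • rep n m π (toSimplexForm (star h1 α.1))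
      rw [star_permAct, map_units_smul, toSimplexForm_permAct]

theorem Pminus_zero_zero (n : ℕ) : Pminus n 0 0 = ⊥ := by
  rw [eq_bot_iff]
  intro ω hω
  obtain ⟨α, hα, rfl⟩ := mem_Pminus_iff.mp hω
  rw [eq_zero_of_mem_homForms (by norm_num) hα, map_zero, map_zero]
  exact Submodule.zero_mem _

/-- The star of the constant `1` is, up to sign, `dλ₀ ∧ ⋯ ∧ dλₙ`. Contracting it with a coordinate
vector gives a constant volume form on the simplex, whose traces on the facets vanish. -/
theorem P0_zero_top_ne_bot (n : ℕ) : P0 n 0 n ≠ ⊥ := by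
  have h : 0 + (n + 1) = n + 1 := by omega
  let ζ : PolyAlt n 0 := AlternatingMap.constOfIsEmpty ℝ _ (Fin 0) 1
  have hζ : ζ ∈ homForms n 0 0 := fun _ => by
    exact_mod_cast mem_homPoly_natCast.mpr (isHomogeneous_one (Fin (n + 1)) ℝ)
  have hζ0 : ζ ≠ 0 := fun h0 => by
    have := DFunLike.congr_fun h0 (basisTuple Fin.elim0)
    exact one_ne_zero this
  have hvol : star h ζ ∈ homForms n 0 (n + 1) := (star_mem_homForms h (by simp)).mpr hζ
  have hw : wedgeSum ((star h ζ).curryLeft (Pi.single 0 1)) = star h ζ :=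
    (eq_wedgeSum_of_wedgeSum_eq_zero (eq_zero_of_card_lt (by omega) _)).symm
  have hω := curryLeft_mem_homForms hvol 0
  refine (Submodule.ne_bot_iff _).mpr ⟨toSimplexForm ((star h ζ).curryLeft (Pi.single 0 1)),
    ⟨mem_P_iff.mpr ⟨_, hω, rfl⟩, ?_⟩, ?_⟩
  · refine (toSimplexForm_mem_zeroTrace_iff_wedgeSum hω).mpr ?_
    rw [hw]
    exact star_mem_vanishing h ζ
  · rw [Ne, toSimplexForm_eq_zero_iff_wedgeSum hω, hw, (star_injective h).eq_iff' (map_zero _)]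
    exact hζ0

theorem isEmpty_repPminus_equiv (n : ℕ) :
    IsEmpty ((repPminus n 0 0).Equiv ((repP0 n 0 n).tprod (signRep n))) := by
  refine ⟨fun φ => P0_zero_top_ne_bot n ?_⟩
  have hs : Subsingleton (Pminus n 0 0) := by
    rw [Pminus_zero_zero]
    infer_instance
  have hs' : Subsingleton (P0 n 0 n) :=
    ((TensorProduct.rid ℝ (P0 n 0 n)).symm ≪≫ₗ φ.toLinearEquiv.symm).toEquiv.subsingleton
  exact Submodule.subsingleton_iff_eq_bot.mp hs'

end Isomorphisms

end FEEC

theorem proposition2p1 (n : ℕ) :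
    (∀ (r : ℤ) (k : ℕ), k ≤ n →
      Nonempty ((FEEC.repP n r k).Equiv
        ((FEEC.repPminus0 n (r + k + 1) (n - k)).tprod (FEEC.signRep n)))) ∧
    (∀ (r : ℤ) (k : ℕ), k ≤ n → ¬(r = 0 ∧ k = 0) →
      Nonempty ((FEEC.repPminus n r k).Equiv
        ((FEEC.repP0 n (r + k) (n - k)).tprod (FEEC.signRep n)))) ∧
    (FEEC.Pminus n 0 0 = ⊥ ∧ FEEC.P0 n 0 n ≠ ⊥ ∧
      IsEmpty ((FEEC.repPminus n 0 0).Equiv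
        ((FEEC.repP0 n 0 n).tprod (FEEC.signRep n)))) :=
  ⟨fun r _ hk => FEEC.nonempty_repP_equiv (Nat.add_sub_cancel' hk) r,
    fun _ _ hk hrk => FEEC.nonempty_repPminus_equiv (Nat.add_sub_cancel' hk) hrk,
    FEEC.Pminus_zero_zero n, FEEC.P0_zero_top_ne_bot n, FEEC.isEmpty_repPminus_equiv n⟩
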